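/- Let $n\ge 1$ and let $U\subseteq\mathbb R^n$ be open. Let $G(q)=\alpha qq^T+\beta q^T+q\beta^T+\gamma$ and $\tilde G(q)=\tilde\alpha qq^T+\tilde\beta q^T+q\tilde\beta^T+\tilde\gamma$, where $\alpha,\tilde\alpha\in\mathbb R$, $\beta,\tilde\beta\in\mathbb R^n$ and $\gamma,\tilde\gamma$ are symmetric constant matrices, and suppose $\det\tilde G\ne0$ on $U$. Put $N=\alpha q+\beta$, $\tilde N=\tilde\alpha q+\tilde\beta$, $F=Np^T-pN^T$, $\tilde F=\tilde Np^T-p\tilde N^T$, and $\mathrm{cof}(G+\xi\tilde G)=\sum_{i=0}^{n-1}A_i(q)\xi^i$, $\det(G+\xi\tilde G)=\sum_{i=0}^nD_i(q)\xi^i$, where $\mathrm{cof}$ is normalised by $\mathrm{cof}(B)B=\det(B)I$. Let $\ddot q=M(q)$ be a bi-cofactor system on $U$: there are smooth functions $k,\tilde k$ on $U$ with $2\,\mathrm{cof}(G)M+\nabla k=0=2\,\mathrm{cof}(\tilde G)M+\nabla\tilde k$ (and $k=\tilde k$ if $n=1$). On $\mathbb R^{2n+1}$ with coordinates $(q,p,c)$,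 $q\in U$, consider the operators $$\Pi_0=\begin{bmatrix}0&-\tilde G&0\\ \tilde G&-\tilde F&-2c\tilde N\\ *&*&0\end{bmatrix},\qquad \Pi_1=\begin{bmatrix}0&G&p\\-G&F&M+2cN\\ *&*&0\end{bmatrix},$$ where $*$ makes the matrices skew-symmetric. Suppose that the roots $\lambda_1(q),\dots,\lambda_n(q)$ of $\det(G+\lambda\tilde G)=0$ (listed with multiplicity) are real, smooth and functionally independent on $U$, i.e. $d\lambda_1,\dots,d\lambda_n$ are linearly independent at every point of $U$. Put $\Omega=G\tilde G^{-1}\tilde N-N$ and $$\mu_i(q,p)=-\frac12\,\frac{\Omega^T\mathrm{cof}(G+\lambda_i(q)\tilde G)\,p}{\Omega^T\mathrm{cof}(G+\lambda_i(q)\tilde G)\,\Omega},\qquad c'=-2c\det\tilde G .$$ Then on $U$ the $\lambda_i(q)$ are pairwise distinct and the denominators of the $\mu_i$ do not vanish. Moreover, every point of $U$ has an open neighbourhood $V\subseteq U$ such that $\lambda$ is a smooth coordinate system on $V$, $(\lambda,\mu,c')$ is a smooth coordinate system on $V\times\mathbb R^n\times\mathbb R$, there are smooth quasi-potentials $k_0=k,k_1,\dots,k_{n-1}=\tilde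 k$ on $V$ with $2A_iM+\nabla k_i=0$ for all $i$, and for every such choice of $k_0,\dots,k_{n-1}$, with $$h_i=p^TA_ip+k_i-2cD_i\quad(0\le i\le n-1),\qquad h_n=-2cD_n,$$ the following hold. 1. $(\lambda,\mu,c')$ are Darboux–Nijenhuis coordinates: in them, with $\Lambda=\mathrm{diag}(\lambda_1,\dots,\lambda_n)$, $$\Pi_0=\begin{bmatrix}0&I&0\\-I&0&0\\ *&*&0\end{bmatrix},\qquad \Pi_1=\begin{bmatrix}0&\Lambda&\partial h_{n-1}/\partial\mu\\-\Lambda&0&-\partial h_{n-1}/\partial\lambda\\ *&*&0\end{bmatrix}.$$ 2. There are smooth functions $f_1,\dots,f_n$ of two variables such that, for $i=0,\dots,n$, $$h_i(\lambda,\mu,c')=-\sum_{j=1}^n\frac{\partial\rho_i}{\partial\lambda_j}\,\frac{f_j(\lambda_j,\mu_j)}{\Delta_j}+c'\rho_i(\lambda),$$ where $\Delta_j=\prod_{m\ne j}(\lambda_j-\lambda_m)$ and the Viète polynomials $\rho_i$ are given by $\prod_j(\xi-\lambda_j)=\sum_{i=0}^n\rho_i\xi^i$. (For $n=1$ this reads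 $h_0=f(\lambda,\mu)-c'\lambda$, $h_1=c'$.) 3. Let $k_\xi=\sum_{i=0}^{n-1}k_i\xi^i$, and let $l_\xi=\sum_{i=0}^{n-1}l_i\xi^i$ be given by the recursion formula $l_\xi=\dfrac{\det(G+\xi\tilde G)}{\det\tilde G}\tilde k-\xi k_\xi$. In the coordinates $\lambda$ it becomes $$l_\xi(\lambda)=\det(\xi I-\Lambda)\,\tilde k(\lambda)-\xi k_\xi(\lambda).$$ -/

import Mathlib

open Matrix Polynomial
open scoped ContDiff

/-- The data `(α, β, γ)`, with `γ` symmetric, of a matrix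
`G(q) = α q qᵀ + β qᵀ + q βᵀ + γ`. -/
structure CofactorData (n : ℕ) where
  α : ℝ
  β : Fin n → ℝ
  γ : Matrix (Fin n) (Fin n) ℝ
  symm : γ.IsSymm

namespace CofactorData

variable {n : ℕ}

/-- `G(q) = α q qᵀ + β qᵀ + q βᵀ + γ`. -/
def mat (G : CofactorData n) (q : Fin n → ℝ) : Matrix (Fin n) (Fin n) ℝ :=
  G.α • vecMulVec q q + vecMulVec G.β q + vecMulVec q G.β + G.γ

/-- `N(q) = α q + β`. -/
def N (G : CofactorData n) (q : Fin n → ℝ) : Fin n → ℝ :=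
  G.α • q + G.β

/-- `F(q,p) = N pᵀ - p Nᵀ`. -/
def F (G : CofactorData n) (q p : Fin n → ℝ) : Matrix (Fin n) (Fin n) ℝ :=
  vecMulVec (G.N q) p - vecMulVec p (G.N q)

end CofactorData

namespace BiCofactor

variable {n : ℕ}

/-- Gradient of a scalar function of `q`. -/
noncomputable def grad (f : (Fin n → ℝ) → ℝ) (q : Fin n → ℝ) : Fin n → ℝ :=
  fun i => fderiv ℝ f q (Pi.single i 1)

/-- `M`, `k`, `k̃` form a bi-cofactor system on the open set `U`:
`q̈ = M(q)` with `2 cof(G) M + ∇k = 0` and `2 cof(G̃) M + ∇k̃ = 0`, i.e.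
`M = -½ cof(G)⁻¹ ∇k = -½ cof(G̃)⁻¹ ∇k̃` wherever both cofactor matrices are invertible.
In dimension one both cofactor matrices are `1` and the two integrals
`q̇ᵀ cof(G) q̇ + k`, `q̇ᵀ cof(G̃) q̇ + k̃` are taken to be the same. -/
structure IsBiCofactorSystem (U : Set (Fin n → ℝ)) (G Gt : CofactorData n)
    (M : (Fin n → ℝ) → Fin n → ℝ) (k kt : (Fin n → ℝ) → ℝ) : Prop where
  det_ne_zero : ∀ q ∈ U, (Gt.mat q).det ≠ 0
  smooth_k : ContDiffOn ℝ ∞ k U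
  smooth_kt : ContDiffOn ℝ ∞ kt U
  quasi_k : ∀ q ∈ U, (2 : ℝ) • ((G.mat q).adjugate *ᵥ M q) + grad k q = 0
  quasi_kt : ∀ q ∈ U, (2 : ℝ) • ((Gt.mat q).adjugate *ᵥ M q) + grad kt q = 0
  dim_one : n = 1 → ∀ q ∈ U, k q = kt q

/-- The pencil `G + ξ G̃` as a matrix of polynomials in `ξ`. -/
noncomputable def pencil (G Gt : CofactorData n) (q : Fin n → ℝ) :
    Matrix (Fin n) (Fin n) ℝ[X] :=
  (G.mat q).map C + (X : ℝ[X]) • (Gt.mat q).map C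

/-- `A_i(q)`, where `cof(G + ξ G̃) = ∑ A_i ξ^i`. -/
noncomputable def cofCoeff (G Gt : CofactorData n) (i : ℕ) (q : Fin n → ℝ) :
    Matrix (Fin n) (Fin n) ℝ :=
  (pencil G Gt q).adjugate.map (fun P => P.coeff i)

/-- `D_i(q)`, where `det(G + ξ G̃) = ∑ D_i ξ^i`. -/
noncomputable def detCoeff (G Gt : CofactorData n) (i : ℕ) (q : Fin n → ℝ) : ℝ :=
  (pencil G Gt q).det.coeff i

/-- `κ_0, …, κ_{n-1}` are quasi-potentials on `V` of the given bi-cofactor system: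
`κ_0 = k`, `κ_{n-1} = k̃`, and `2 A_i M + ∇κ_i = 0`, so that `q̇ᵀ A_i q̇ + κ_i` is an
integral of motion of `q̈ = M(q)`. -/
structure IsQuasiPotentialFamily (V : Set (Fin n → ℝ)) (G Gt : CofactorData n)
    (M : (Fin n → ℝ) → Fin n → ℝ) (k kt : (Fin n → ℝ) → ℝ)
    (κ : Fin n → (Fin n → ℝ) → ℝ) : Prop where
  smooth : ∀ i, ContDiffOn ℝ ∞ (κ i) V
  first : ∀ i : Fin n, (i : ℕ) = 0 → ∀ q ∈ V, κ i q = k q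
  last : ∀ i : Fin n, (i : ℕ) + 1 = n → ∀ q ∈ V, κ i q = kt q
  quasi : ∀ i : Fin n, ∀ q ∈ V,
    (2 : ℝ) • (cofCoeff G Gt i q *ᵥ M q) + grad (κ i) q = 0

/-- `lam_1(q), …, lam_n(q)` are, on `U`, smooth real functions and all the roots
(with multiplicity) of `det(G + ξ G̃) = 0`. -/
structure IsRootFamily (U : Set (Fin n → ℝ)) (G Gt : CofactorData n)
    (lam : Fin n → (Fin n → ℝ) → ℝ) : Prop where
  smooth : ∀ i, ContDiffOn ℝ ∞ (lam i) U
  roots : ∀ q ∈ U, ∀ ξ : ℝ,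
    (G.mat q + ξ • Gt.mat q).det = (Gt.mat q).det * ∏ i, (ξ - lam i q)

/-- Functional independence on `U`: the differentials are linearly independent at every
point of `U`. -/
def FunctionallyIndependentOn (U : Set (Fin n → ℝ)) (lam : Fin n → (Fin n → ℝ) → ℝ) : Prop :=
  ∀ q ∈ U, LinearIndependent ℝ (fun i => fderiv ℝ (lam i) q)

/-- The space `ℝ^{2n+1}`, with points `(q, p, c)` or, in new coordinates, `(λ, μ, c')`. -/
abbrev Phase (n : ℕ) : Type := (Fin n → ℝ) × (Fin n → ℝ) × ℝ

/-- Indices of the `2n + 1` coordinates, in block form `2n | 1`. -/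
abbrev Idx (n : ℕ) : Type := (Fin n ⊕ Fin n) ⊕ Unit

/-- The coordinate functions on `ℝ^{2n+1}`. -/
def coord : Idx n → Phase n → ℝ
  | .inl (.inl i), x => x.1 i
  | .inl (.inr i), x => x.2.1 i
  | .inr _, x => x.2.2

/-- The standard basis of `ℝ^{2n+1}`. -/
def basisVec : Idx n → Phase n
  | .inl (.inl i) => (Pi.single i 1, 0, 0)
  | .inl (.inr i) => (0, Pi.single i 1, 0)
  | .inr _ => (0, 0, 1)

/-- Partial derivative of a function on `ℝ^{2n+1}`. -/
noncomputable def partialDeriv (a : Idx n) (f : Phase n → ℝ) (x : Phase n) : ℝ :=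
  fderiv ℝ f x (basisVec a)

/-- A skew-symmetric `(2n+1) × (2n+1)` matrix `[S, v; -vᵀ, 0]` from its upper blocks. -/
def bordered (S : Matrix (Fin n ⊕ Fin n) (Fin n ⊕ Fin n) ℝ) (v : Fin n ⊕ Fin n → ℝ) :
    Matrix (Idx n) (Idx n) ℝ :=
  fromBlocks S (replicateCol Unit v) (-replicateRow Unit v) 0

/-- The operator `Π₀` in the coordinates `(q, p, c)`. -/
def Pi0 (Gt : CofactorData n) (x : Phase n) : Matrix (Idx n) (Idx n) ℝ :=
  bordered
    (fromBlocks 0 (-Gt.mat x.1) (Gt.mat x.1) (-Gt.F x.1 x.2.1))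
    (Sum.elim 0 (-(2 * x.2.2) • Gt.N x.1))

/-- The operator `Π₁` in the coordinates `(q, p, c)`. -/
def Pi1 (G : CofactorData n) (M : (Fin n → ℝ) → Fin n → ℝ) (x : Phase n) :
    Matrix (Idx n) (Idx n) ℝ :=
  bordered
    (fromBlocks 0 (G.mat x.1) (-G.mat x.1) (G.F x.1 x.2.1))
    (Sum.elim x.2.1 (M x.1 + (2 * x.2.2) • G.N x.1))

/-- The Jacobian matrix of a map of `ℝ^{2n+1}`. -/
noncomputable def jacobian (Φ : Phase n → Phase n) (x : Phase n) : Matrix (Idx n) (Idx n) ℝ :=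
  Matrix.of fun a b => partialDeriv b (fun y => coord a (Φ y)) x

/-- The matrix `J Π Jᵀ`, at the point with old coordinates `x`, of a contravariant 2-tensor `Π`
in the new coordinates `Φ`. -/
noncomputable def transformed (Φ : Phase n → Phase n) (P : Phase n → Matrix (Idx n) (Idx n) ℝ)
    (x : Phase n) : Matrix (Idx n) (Idx n) ℝ :=
  jacobian Φ x * P x * (jacobian Φ x)ᵀ

/-- The Hamiltonians `h_i = pᵀ A_i p + κ_i - 2 c D_i` for `i < n`, and `h_n = -2 c D_n`. -/
noncomputable def hamiltonian (G Gt : CofactorData n) (κ : Fin n → (Fin n → ℝ) → ℝ)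
    (i : ℕ) (x : Phase n) : ℝ :=
  (if h : i < n then x.2.1 ⬝ᵥ (cofCoeff G Gt i x.1 *ᵥ x.2.1) + κ ⟨i, h⟩ x.1 else 0)
    - 2 * x.2.2 * detCoeff G Gt i x.1

/-- `Ω = G G̃⁻¹ Ñ - N`. -/
noncomputable def Om (G Gt : CofactorData n) (q : Fin n → ℝ) : Fin n → ℝ :=
  (G.mat q * (Gt.mat q)⁻¹) *ᵥ Gt.N q - G.N q

/-- The denominator `Ωᵀ cof(G + λ_i G̃) Ω` of `μ_i`. -/
noncomputable def muDen (G Gt : CofactorData n) (lam : Fin n → (Fin n → ℝ) → ℝ) (i : Fin n)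
    (q : Fin n → ℝ) : ℝ :=
  Om G Gt q ⬝ᵥ ((G.mat q + lam i q • Gt.mat q).adjugate *ᵥ Om G Gt q)

/-- `μ_i = -½ Ωᵀ cof(G + λ_i G̃) p / Ωᵀ cof(G + λ_i G̃) Ω`. -/
noncomputable def mu (G Gt : CofactorData n) (lam : Fin n → (Fin n → ℝ) → ℝ) (i : Fin n)
    (q p : Fin n → ℝ) : ℝ :=
  -(1 / 2) * ((Om G Gt q ⬝ᵥ ((G.mat q + lam i q • Gt.mat q).adjugate *ᵥ p)) /
    muDen G Gt lam i q)

/-- The map `(q, p, c) ↦ (λ(q), μ(q,p), c')` with `c' = -2 c det G̃`. -/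
noncomputable def dnMap (G Gt : CofactorData n) (lam : Fin n → (Fin n → ℝ) → ℝ)
    (x : Phase n) : Phase n :=
  (fun i => lam i x.1, fun i => mu G Gt lam i x.1 x.2.1, -2 * x.2.2 * (Gt.mat x.1).det)

/-- The Viète polynomials: `∏ (ξ - y_j) = ∑ ρ_i(y) ξ^i`. -/
noncomputable def viete (i : ℕ) (y : Fin n → ℝ) : ℝ :=
  (∏ j, ((X : ℝ[X]) - C (y j))).coeff i

/-- `Δ_k(y) = ∏_{j ≠ k} (y_k - y_j)`. -/
def Delta (k : Fin n) (y : Fin n → ℝ) : ℝ :=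
  ∏ j ∈ Finset.univ.erase k, (y k - y j)

/-- `κ_ξ(q) = ∑_{i<n} κ_i(q) ξ^i`. -/
def genFun (κ : Fin n → (Fin n → ℝ) → ℝ) (ξ : ℝ) (q : Fin n → ℝ) : ℝ :=
  ∑ i, κ i q * ξ ^ (i : ℕ)

/-- The quasi-potentials `l_i` produced by the recursion: `l_i(q)` is the coefficient of `ξ^i`
in `l_ξ = (det(G + ξ G̃) / det G̃) k̃ - ξ κ_ξ`. -/
noncomputable def nextPotential (G Gt : CofactorData n) (kt : (Fin n → ℝ) → ℝ)
    (κ : Fin n → (Fin n → ℝ) → ℝ) (i : Fin n) (q : Fin n → ℝ) : ℝ :=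
  (C (kt q / (Gt.mat q).det) * (pencil G Gt q).det
    - X * ∑ j, C (κ j q) * X ^ (j : ℕ)).coeff i

/-- The Darboux-Nijenhuis form of the pair `Π₀, Π₁` in the coordinates `Φ`; here `h` is the
function `h_{n-1}`, and its partial derivatives with respect to `λ` and `μ` are those of
`h ∘ Φ⁻¹`. -/
def HasDNForm (Φ : OpenPartialHomeomorph (Phase n) (Phase n))
    (P0 P1 : Phase n → Matrix (Idx n) (Idx n) ℝ) (h : Phase n → ℝ) : Prop :=
  ∀ z ∈ Φ.target,
    transformed Φ P0 (Φ.symm z) = bordered (fromBlocks 0 1 (-1) 0) 0 ∧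
    transformed Φ P1 (Φ.symm z) =
      bordered (fromBlocks 0 (diagonal z.1) (-diagonal z.1) 0)
        (Sum.elim
          (fun i => partialDeriv (.inl (.inr i)) (h ∘ Φ.symm) z)
          (fun i => -partialDeriv (.inl (.inl i)) (h ∘ Φ.symm) z))

end BiCofactor

/-! ### Jacobi's formula, coefficients of products of linear factors, Lagrange interpolation. -/

namespace BiCofactor
variable {n : ℕ}

/-! Everything rests on the differentials of the roots diagonalising the pencil. Jacobi's formula
gives `∇det(G + ξG̃) = 2 cof(G + ξG̃)(N + ξÑ)`. Differentiating `det(G + ξG̃) = det G̃ ∏(ξ - λ_j)`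
therefore gives `2 cof(G + ξG̃) Ω = det G̃ ∑_j ∏_{m≠j}(ξ - λ_m) ∇λ_j`
(`IsRootFamily.adjugate_mulVec_Om`). At a simple root `ξ = λ_a` one term survives, so `∇λ_a` spans
the image of `Ω` under the cofactor matrix and is killed by `G + λ_a G̃`. Hence the `∇λ_a` are
orthogonal for `G̃`, and every `A_i` maps `G̃∇λ_a` to a multiple of `∇λ_a`; this is the content of
`RootFrame`.

Distinctness of the roots uses a conserved quantity: `α det G - Nᵀ cof(G) N` is the determinant of
the constant matrix `[γ, β; βᵀ, α]`. For the pencil it is a function `W(ξ)` that does not depend on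
`q`, and the denominator of `μ_a` equals `-W(λ_a)`. At a multiple root the denominator vanishes.
Since `λ` is a local diffeomorphism, there is a nearby point with the same `λ_a` and all roots
distinct, where the denominator cannot vanish: a contradiction.

In a chart `λ` the definition of `μ` amounts to `p = -G̃ w` with `w = ∑ μ_a dλ_a`. Differentiating
this relation implicitly yields the Jacobian matrix of `(λ, μ, c')`. The canonical form of `Π₀` is
then a cancellation; that of `Π₁` also needs the derivative of `(G + λ_a G̃)∇λ_a = 0`
(`antisymm_rootHess`) and a comparison of the last column with the differential of `h_{n-1}`.

For the Stäckel form, the kinetic part of `h_i` is diagonal in `μ` with coefficients `W(λ_a)/Δ_a`,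
up to a constant and Viète factors. The potentials `k_i` are recovered by Lagrange interpolation
from the values `∑ k_i λ_a^i`, each of which depends on `λ_a` alone because its differential is a
multiple of `dλ_a`.

Quasi-potentials exist because in the coordinates `λ` both `k` and `k̃` are exact: equality of the
mixed derivatives of `k` forces an Euler–Poisson–Darboux equation on `k̃`. That equation makes all
the intermediate 1-forms closed, and the image of the chart is convex. -/

/-- Jacobi's formula for the derivative of a determinant. -/
theorem hasDerivAt_det {m : Type*} [Fintype m] [DecidableEq m] {B : ℝ → Matrix m m ℝ}
    {B' : Matrix m m ℝ} {t : ℝ} (h : ∀ i j, HasDerivAt (fun s => B s i j) (B' i j) t) :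
    HasDerivAt (fun s => (B s).det) ((B t).adjugate * B').trace t := by
  have h1 : HasDerivAt (fun s => (B s).det)
      (∑ σ : Equiv.Perm m, (Equiv.Perm.sign σ : ℝ) *
        ∑ i, (∏ j ∈ Finset.univ.erase i, B t (σ j) j) • B' (σ i) i) t := by
    simp only [Matrix.det_apply']
    exact HasDerivAt.fun_sum fun σ _ =>
      (HasDerivAt.fun_finsetProd fun i _ => h (σ i) i).const_mul _
  convert h1 using 1
  have h2 : ∀ i, ((B t).adjugate * B') i i =
      ∑ σ : Equiv.Perm m, (Equiv.Perm.sign σ : ℝ) *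
        ((∏ j ∈ Finset.univ.erase i, B t (σ j) j) • B' (σ i) i) := by
    intro i
    -- By Cramer's rule this diagonal entry is a determinant in which one column is differentiated.
    have : ((B t).adjugate * B') i i = ((B t).updateCol i (fun r => B' r i)).det := by
      rw [← Matrix.cramer_apply, Matrix.cramer_eq_adjugate_mulVec]; rfl
    rw [this, Matrix.det_apply']
    refine Finset.sum_congr rfl fun σ _ => ?_
    congr 1
    rw [← Finset.mul_prod_erase _ _ (Finset.mem_univ i), smul_eq_mul, mul_comm]
    congr 1
    · refine Finset.prod_congr rfl fun j hj => ?_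
      rw [Matrix.updateCol_ne (Finset.ne_of_mem_erase hj)]
    · simp
  simp only [Matrix.trace, Matrix.diag, h2, Finset.mul_sum]
  exact Finset.sum_comm

/-- The coefficient of `ξ^i` in `∏ j ∈ s, (ξ - y j)`. -/
noncomputable def prodCoeff (s : Finset (Fin n)) (i : ℕ) (y : Fin n → ℝ) : ℝ :=
  (∏ j ∈ s, ((X : ℝ[X]) - C (y j))).coeff i

theorem prodCoeff_insert_zero {s : Finset (Fin n)} {a : Fin n} (ha : a ∉ s) (y : Fin n → ℝ) :
    prodCoeff (insert a s) 0 y = -(y a * prodCoeff s 0 y) := by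
  simp [prodCoeff, Finset.prod_insert ha, sub_mul]

theorem prodCoeff_insert_succ {s : Finset (Fin n)} {a : Fin n} (ha : a ∉ s) (i : ℕ)
    (y : Fin n → ℝ) :
    prodCoeff (insert a s) (i + 1) y = prodCoeff s i y - y a * prodCoeff s (i + 1) y := by
  simp [prodCoeff, Finset.prod_insert ha, sub_mul]

/-- The product is affine in each `y_j`, with slope minus the product of the remaining factors. -/
theorem hasFDerivAt_prodCoeff (s : Finset (Fin n)) (i : ℕ) (y : Fin n → ℝ) :
    HasFDerivAt (prodCoeff s i)
      (-∑ j ∈ s, prodCoeff (s.erase j) i y • (ContinuousLinearMap.proj j : (Fin n → ℝ) →L[ℝ] ℝ))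
      y := by
  induction s using Finset.induction_on generalizing i with
  | empty =>
    have : prodCoeff (∅ : Finset (Fin n)) i = fun _ => (1 : ℝ[X]).coeff i := by
      ext; simp [prodCoeff]
    rw [this]; simpa using hasFDerivAt_const _ _
  | insert a s ha ih =>
    have hp : HasFDerivAt (fun y : Fin n → ℝ => y a)
      (ContinuousLinearMap.proj a : (Fin n → ℝ) →L[ℝ] ℝ) y := hasFDerivAt_apply a y
    have he : ∀ j ∈ s, (insert a s).erase j = insert a (s.erase j) := fun j hj =>
      Finset.erase_insert_of_ne (fun h => ha (h ▸ hj))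
    have hn : ∀ j, a ∉ s.erase j := fun j h => ha (Finset.mem_of_mem_erase h)
    rw [Finset.sum_insert ha, Finset.erase_insert ha]
    cases i with
    | zero =>
      rw [show prodCoeff (insert a s) 0 = fun y => -(y a * prodCoeff s 0 y) from
        funext (prodCoeff_insert_zero ha)]
      refine (hp.mul (ih 0)).neg.congr_fderiv (ContinuousLinearMap.ext fun v => ?_)
      have : ∑ j ∈ s, prodCoeff ((insert a s).erase j) 0 y * v j =
          - (y a * ∑ j ∈ s, prodCoeff (s.erase j) 0 y * v j) := by
        rw [Finset.mul_sum, ← Finset.sum_neg_distrib]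
        refine Finset.sum_congr rfl fun j hj => ?_
        rw [he j hj, prodCoeff_insert_zero (hn j)]; ring
      simp [this]; ring
    | succ i =>
      rw [show prodCoeff (insert a s) (i + 1) = fun y =>
        prodCoeff s i y - y a * prodCoeff s (i + 1) y from funext (prodCoeff_insert_succ ha i)]
      refine ((ih i).sub (hp.mul (ih (i + 1)))).congr_fderiv (ContinuousLinearMap.ext fun v => ?_)
      have : ∑ j ∈ s, prodCoeff ((insert a s).erase j) (i + 1) y * v j =
          ∑ j ∈ s, prodCoeff (s.erase j) i y * v j
            - y a * ∑ j ∈ s, prodCoeff (s.erase j) (i + 1) y * v j := by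
        rw [Finset.mul_sum, ← Finset.sum_sub_distrib]
        refine Finset.sum_congr rfl fun j hj => ?_
        rw [he j hj, prodCoeff_insert_succ (hn j)]; ring
      simp [this]; ring

theorem contDiff_prodCoeff (s : Finset (Fin n)) (i : ℕ) : ContDiff ℝ ∞ (prodCoeff s i) := by
  induction s using Finset.induction_on generalizing i with
  | empty =>
    have : prodCoeff (∅ : Finset (Fin n)) i = fun _ => (1 : ℝ[X]).coeff i := by
      ext; simp [prodCoeff]
    rw [this]; exact contDiff_const
  | insert a s ha ih =>
    cases i with
    | zero =>
      rw [show prodCoeff (insert a s) 0 = fun y => -(y a * prodCoeff s 0 y) from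
        funext (prodCoeff_insert_zero ha)]
      exact ((contDiff_apply ℝ ℝ a).mul (ih 0)).neg
    | succ i =>
      rw [show prodCoeff (insert a s) (i + 1) = fun y =>
        prodCoeff s i y - y a * prodCoeff s (i + 1) y from funext (prodCoeff_insert_succ ha i)]
      exact (ih i).sub ((contDiff_apply ℝ ℝ a).mul (ih (i + 1)))

theorem natDegree_prod_erase_lt (a : Fin n) (y : Fin n → ℝ) :
    (∏ j ∈ Finset.univ.erase a, ((X : ℝ[X]) - C (y j))).natDegree < n := by
  rw [natDegree_prod_of_monic _ _ fun j _ => monic_X_sub_C _]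
  have := a.pos
  simp; omega

theorem sum_prodCoeff_mul_pow (a : Fin n) (y : Fin n → ℝ) (ξ : ℝ) :
    ∑ i : Fin n, prodCoeff (Finset.univ.erase a) i y * ξ ^ (i : ℕ) =
      ∏ j ∈ Finset.univ.erase a, (ξ - y j) := by
  have h := eval_eq_sum_range' (natDegree_prod_erase_lt a y) ξ
  rw [eval_prod] at h
  simp only [eval_sub, eval_X, eval_C] at h
  rw [h, Finset.sum_range]; rfl

theorem prodCoeff_erase_last (a : Fin n) (y : Fin n → ℝ) :
    prodCoeff (Finset.univ.erase a) (n - 1) y = 1 := by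
  have h : (∏ j ∈ Finset.univ.erase a, ((X : ℝ[X]) - C (y j))).Monic :=
    monic_prod_of_monic _ _ fun j _ => monic_X_sub_C _
  have h2 : (∏ j ∈ Finset.univ.erase a, ((X : ℝ[X]) - C (y j))).natDegree = n - 1 := by
    rw [natDegree_prod_of_monic _ _ fun j _ => monic_X_sub_C _]; simp
  have := h.coeff_natDegree
  rwa [h2] at this

/-- The two products share all factors except `X - y_b` and `X - y_a`, whose difference is the
constant `y_a - y_b`. This is the algebra behind closedness of the potential forms. -/
theorem prodCoeff_erase_sub {a b : Fin n} (h : a ≠ b) (i : ℕ) (y : Fin n → ℝ) :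
    prodCoeff (Finset.univ.erase a) i y - prodCoeff (Finset.univ.erase b) i y =
      (y a - y b) * prodCoeff ((Finset.univ.erase a).erase b) i y := by
  have h1 : (Finset.univ.erase a : Finset (Fin n)) = insert b ((Finset.univ.erase a).erase b) :=
    (Finset.insert_erase (by simp [h.symm])).symm
  have h2 : (Finset.univ.erase b : Finset (Fin n)) = insert a ((Finset.univ.erase a).erase b) := by
    rw [Finset.erase_right_comm]; exact (Finset.insert_erase (by simp [h])).symm
  have hb : b ∉ (Finset.univ.erase a : Finset (Fin n)).erase b := by simp
  have ha : a ∉ (Finset.univ.erase a : Finset (Fin n)).erase b := by simp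
  rw [h1, h2, Finset.erase_insert hb]
  cases i with
  | zero => rw [prodCoeff_insert_zero ha, prodCoeff_insert_zero hb]; ring
  | succ i => rw [prodCoeff_insert_succ ha, prodCoeff_insert_succ hb]; ring

theorem grad_viete (i : ℕ) (y : Fin n → ℝ) (a : Fin n) :
    grad (viete i) y a = -prodCoeff (Finset.univ.erase a) i y := by
  have h : HasFDerivAt (viete i) _ y := hasFDerivAt_prodCoeff Finset.univ i y
  rw [grad, h.fderiv]
  simp [Pi.single_apply]

theorem viete_pred (hn : 1 ≤ n) (y : Fin n → ℝ) : viete (n - 1) y = -∑ j, y j := by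
  have := prod_X_sub_C_coeff_card_pred (Finset.univ : Finset (Fin n)) y
    (by simpa using Nat.pos_of_ne_zero (by omega))
  simpa [viete] using this

theorem prodCoeff_erase_top (a : Fin n) (y : Fin n → ℝ) :
    prodCoeff (Finset.univ.erase a) n y = 0 :=
  coeff_eq_zero_of_natDegree_lt (natDegree_prod_erase_lt a y)

theorem Delta_ne_zero {y : Fin n → ℝ} (hy : Function.Injective y) (a : Fin n) :
    Delta a y ≠ 0 :=
  Finset.prod_ne_zero_iff.2 fun j hj => sub_ne_zero.2 fun h => by
    simp [hy h] at hj

theorem prod_erase_eval {y : Fin n → ℝ} {a b : Fin n} (h : b ≠ a) :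
    ∏ j ∈ Finset.univ.erase a, (y b - y j) = 0 :=
  Finset.prod_eq_zero (i := b) (by simp [h]) (sub_self _)

/-- Lagrange interpolation at the nodes `y`, coefficient by coefficient. -/
theorem coeff_eq_sum_prodCoeff {y : Fin n → ℝ} (hy : Function.Injective y) (κ : Fin n → ℝ)
    (i : Fin n) :
    κ i = ∑ a, prodCoeff (Finset.univ.erase a) i y * (∑ m, κ m * y a ^ (m : ℕ)) / Delta a y := by
  set P : ℝ[X] := ∑ m : Fin n, C (κ m) * X ^ (m : ℕ) with hP
  have hPd : P.degree < (Finset.univ : Finset (Fin n)).card := by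
    simpa using degree_sum_fin_lt κ
  have hPc : P.coeff i = κ i := by
    simp [hP, coeff_X_pow, Fin.val_inj]
  have hPe : ∀ ξ, P.eval ξ = ∑ m, κ m * ξ ^ (m : ℕ) := fun ξ => by
    simp [hP, eval_finsetSum]
  set Q : ℝ[X] := ∑ a, C (P.eval (y a) / Delta a y) *
    ∏ j ∈ Finset.univ.erase a, ((X : ℝ[X]) - C (y j)) with hQ
  have hQd : Q.degree < (Finset.univ : Finset (Fin n)).card := by
    refine (degree_sum_le _ _).trans_lt ?_
    rw [Finset.sup_lt_iff (by simp)]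
    intro a _
    rw [C_mul', Finset.card_univ, Fintype.card_fin]
    refine (degree_smul_le _ _).trans_lt ?_
    exact (natDegree_lt_iff_degree_lt
      (monic_prod_of_monic _ _ fun j _ => monic_X_sub_C _).ne_zero).1 (natDegree_prod_erase_lt a y)
  have hPQ : P = Q := by
    refine eq_of_degrees_lt_of_eval_index_eq Finset.univ hy.injOn hPd hQd fun b _ => ?_
    rw [show Q.eval (y b) = _ from congrArg _ hQ, eval_finsetSum (s := Finset.univ)
      (g := fun a => C (P.eval (y a) / Delta a y) * _), Finset.sum_eq_single b]
    · rw [eval_mul, eval_C, eval_prod]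
      simp only [eval_sub, eval_X, eval_C]
      exact (div_mul_cancel₀ _ (Delta_ne_zero hy b)).symm
    · intro a _ hab
      rw [eval_mul, eval_prod]
      simp only [eval_sub, eval_X, eval_C]
      rw [prod_erase_eval hab.symm, mul_zero]
    · simp
  rw [← hPc, hPQ, hQ, finsetSum_coeff]
  refine Finset.sum_congr rfl fun a _ => ?_
  rw [coeff_C_mul, ← hPe, prodCoeff]; ring

end BiCofactor

/-! ### Derivatives of `G` and `det G`, and the constant bordered determinant. -/

namespace CofactorData
variable {n : ℕ} (G Gt : CofactorData n)

theorem mat_apply (q : Fin n → ℝ) (i j : Fin n) :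
    G.mat q i j = G.α * (q i * q j) + G.β i * q j + q i * G.β j + G.γ i j := by
  simp [mat, vecMulVec_apply]

theorem transpose_mat (q : Fin n → ℝ) : (G.mat q)ᵀ = G.mat q := by
  ext i j
  rw [transpose_apply, mat_apply, mat_apply, G.symm.apply]; ring

theorem transpose_adjugate_mat (q : Fin n → ℝ) : (G.mat q).adjugateᵀ = (G.mat q).adjugate := by
  rw [adjugate_transpose, transpose_mat]

theorem N_apply (q : Fin n → ℝ) (i : Fin n) : G.N q i = G.α * q i + G.β i := by simp [N]

theorem contDiff_mat_apply (i j : Fin n) : ContDiff ℝ ∞ fun q => G.mat q i j := by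
  simp only [mat_apply]; fun_prop

theorem contDiff_det : ContDiff ℝ ∞ fun q => (G.mat q).det := by
  simp only [Matrix.det_apply']
  exact ContDiff.sum fun σ _ => contDiff_const.mul
    (contDiff_prod fun i _ => G.contDiff_mat_apply _ _)

theorem hasDerivAt_mat (q v : Fin n → ℝ) (i j : Fin n) :
    HasDerivAt (fun t : ℝ => G.mat (q + t • v) i j) (G.N q i * v j + v i * G.N q j) 0 := by
  have h : ∀ k, HasDerivAt (fun t : ℝ => q k + t * v k) (v k) 0 := fun k => by
    simpa using ((hasDerivAt_id (0 : ℝ)).mul_const (v k)).const_add (q k)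
  simp only [mat_apply, Pi.add_apply, Pi.smul_apply, smul_eq_mul]
  refine (((((h i).mul (h j)).const_mul G.α).add ((h j).const_mul (G.β i))).add
    ((h i).mul_const (G.β j))).add_const (G.γ i j) |>.congr_deriv ?_
  simp only [N_apply]; ring

theorem hasDerivAt_det_mat (q v : Fin n → ℝ) :
    HasDerivAt (fun t : ℝ => (G.mat (q + t • v)).det)
      (2 * (((G.mat q).adjugate *ᵥ G.N q) ⬝ᵥ v)) 0 := by
  have h := BiCofactor.hasDerivAt_det (B := fun t : ℝ => G.mat (q + t • v))
    (B' := vecMulVec (G.N q) v + vecMulVec v (G.N q)) (t := 0) fun i j => by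
      simpa [vecMulVec_apply] using G.hasDerivAt_mat q v i j
  refine h.congr_deriv ?_
  simp only [zero_smul, add_zero]
  rw [mul_add, trace_add, mul_vecMulVec, mul_vecMulVec, trace_vecMulVec, trace_vecMulVec,
    dotProduct_comm _ (G.N q), dotProduct_mulVec, ← mulVec_transpose, transpose_adjugate_mat]
  ring

/-- The pencil `G + ξ G̃`, which is again of the same form. -/
def pencilData (ξ : ℝ) : CofactorData n where
  α := G.α + ξ * Gt.α
  β := G.β + ξ • Gt.β
  γ := G.γ + ξ • Gt.γ
  symm := G.symm.add (Gt.symm.smul ξ)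

theorem pencilData_mat (ξ : ℝ) (q : Fin n → ℝ) :
    (pencilData G Gt ξ).mat q = G.mat q + ξ • Gt.mat q := by
  ext i j
  simp [mat_apply, pencilData]; ring

theorem pencilData_N (ξ : ℝ) (q : Fin n → ℝ) :
    (pencilData G Gt ξ).N q = G.N q + ξ • Gt.N q := by
  ext i
  simp [N_apply, pencilData]; ring

/-- The determinant of the symmetric matrix `[γ, β; βᵀ, α]`. -/
noncomputable def borderedDet : ℝ :=
  (fromBlocks G.γ (replicateCol Unit G.β) (replicateRow Unit G.β) (of fun _ _ => G.α)).det

/-- Passing from `[γ, β; βᵀ, α]` to `[G, N; Nᵀ, α]` is a congruence by a unipotent matrix depending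
on `q`, so the determinant does not move. The Schur complement of `G` then gives the left-hand side.
-/
theorem borderedDet_eq (q : Fin n → ℝ) (h : (G.mat q).det ≠ 0) :
    G.α * (G.mat q).det - G.N q ⬝ᵥ ((G.mat q).adjugate *ᵥ G.N q) = G.borderedDet := by
  have e : fromBlocks (G.mat q) (replicateCol Unit (G.N q)) (replicateRow Unit (G.N q))
      (of fun _ _ => G.α) =
      fromBlocks 1 (replicateCol Unit q) 0 1 *
      fromBlocks G.γ (replicateCol Unit G.β) (replicateRow Unit G.β) (of fun _ _ => G.α) *
      fromBlocks 1 0 (replicateRow Unit q) 1 := by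
    rw [fromBlocks_multiply, fromBlocks_multiply]
    congr 1 <;> ext i j <;> simp [mul_apply, mat_apply, N_apply] <;> ring
  have e2 := congrArg det e
  rw [det_mul, det_mul, det_fromBlocks_zero₂₁, det_fromBlocks_zero₁₂] at e2
  simp only [det_one, one_mul, mul_one] at e2
  rw [borderedDet, ← e2]
  let _ : Invertible (G.mat q) := invertibleOfIsUnitDet _ (isUnit_iff_ne_zero.2 h)
  rw [det_fromBlocks₁₁, det_unique (n := Unit), invOf_eq_nonsing_inv, inv_def]
  have : (replicateRow Unit (G.N q) * Ring.inverse (G.mat q).det • (G.mat q).adjugate *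
      replicateCol Unit (G.N q)) default default =
      (G.mat q).det⁻¹ * (G.N q ⬝ᵥ ((G.mat q).adjugate *ᵥ G.N q)) := by
    rw [Matrix.mul_assoc, smul_mul, Matrix.mul_smul, Matrix.smul_apply, Ring.inverse_eq_inv',
      smul_eq_mul]
    rfl
  rw [Matrix.sub_apply, this]
  simp only [of_apply]
  field_simp

theorem contDiff_borderedDet_pencilData : ContDiff ℝ ∞ fun ξ => (pencilData G Gt ξ).borderedDet := by
  simp only [borderedDet, Matrix.det_apply']
  refine ContDiff.sum fun σ _ => contDiff_const.mul (contDiff_prod fun i _ => ?_)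
  rcases i with i | i <;> rcases h : σ _ with j | j <;> simp [pencilData] <;> fun_prop

end CofactorData

/-! ### Gradients of the roots, and the denominators of `μ` as functions of one root. -/

namespace BiCofactor
open CofactorData
variable {n : ℕ} {U : Set (Fin n → ℝ)} {G Gt : CofactorData n} {lam : Fin n → (Fin n → ℝ) → ℝ}

theorem hasDerivAt_line {E F : Type*} [NormedAddCommGroup E] [NormedSpace ℝ E]
    [NormedAddCommGroup F] [NormedSpace ℝ F] {f : E → F} {q : E}
    (h : DifferentiableAt ℝ f q) (v : E) :
    HasDerivAt (fun t : ℝ => f (q + t • v)) (fderiv ℝ f q v) 0 :=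
  h.hasFDerivAt.hasLineDerivAt v

theorem grad_dotProduct (f : (Fin n → ℝ) → ℝ) (q v : Fin n → ℝ) :
    grad f q ⬝ᵥ v = fderiv ℝ f q v := by
  conv_rhs => rw [pi_eq_sum_univ' v]
  rw [map_sum]
  refine Finset.sum_congr rfl fun i _ => ?_
  rw [map_smul, smul_eq_mul, mul_comm]; rfl

theorem eventually_line {U : Set (Fin n → ℝ)} (hU : IsOpen U) {q : Fin n → ℝ} (hq : q ∈ U)
    (v : Fin n → ℝ) : ∀ᶠ t : ℝ in nhds 0, q + t • v ∈ U := by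
  have : ContinuousAt (fun t : ℝ => q + t • v) 0 := by fun_prop
  exact this (hU.mem_nhds (by simpa using hq))

theorem IsRootFamily.differentiableAt (h : IsRootFamily U G Gt lam) (hU : IsOpen U)
    {q : Fin n → ℝ} (hq : q ∈ U) (i : Fin n) : DifferentiableAt ℝ (lam i) q :=
  ((h.smooth i).contDiffAt (hU.mem_nhds hq)).differentiableAt (by simp)

/-- Isolates the part of `N + ξÑ` that the pencil hits; the remainder `Ω` is independent of `ξ`. -/
theorem pencil_N_eq {q : Fin n → ℝ} (hT : (Gt.mat q).det ≠ 0) (ξ : ℝ) :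
    G.N q + ξ • Gt.N q =
      (G.mat q + ξ • Gt.mat q) *ᵥ ((Gt.mat q)⁻¹ *ᵥ Gt.N q) - Om G Gt q := by
  have : Gt.mat q *ᵥ ((Gt.mat q)⁻¹ *ᵥ Gt.N q) = Gt.N q := by
    rw [mulVec_mulVec, mul_nonsing_inv _ (isUnit_iff_ne_zero.2 hT), one_mulVec]
  rw [add_mulVec, smul_mulVec, this, mulVec_mulVec, Om]; abel

theorem adjugate_mulVec_N {q : Fin n → ℝ} (hT : (Gt.mat q).det ≠ 0) (ξ : ℝ) :
    (G.mat q + ξ • Gt.mat q).adjugate *ᵥ (G.N q + ξ • Gt.N q) =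
      (G.mat q + ξ • Gt.mat q).det • ((Gt.mat q)⁻¹ *ᵥ Gt.N q) -
        (G.mat q + ξ • Gt.mat q).adjugate *ᵥ Om G Gt q := by
  rw [pencil_N_eq hT, mulVec_sub, mulVec_mulVec, adjugate_mul, smul_mulVec, one_mulVec]

/-- The gradient of `det (G + ξ G̃) / det G̃` in terms of the roots. -/
theorem IsRootFamily.adjugate_mulVec_Om (h : IsRootFamily U G Gt lam) (hU : IsOpen U)
    {q : Fin n → ℝ} (hq : q ∈ U) (hT : (Gt.mat q).det ≠ 0) (ξ : ℝ) :
    (2 : ℝ) • ((G.mat q + ξ • Gt.mat q).adjugate *ᵥ Om G Gt q) =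
      (Gt.mat q).det • ∑ j, (∏ m ∈ Finset.univ.erase j, (ξ - lam m q)) • grad (lam j) q := by
  refine dotProduct_eq _ _ fun v => ?_
  have h1 := (pencilData G Gt ξ).hasDerivAt_det_mat q v
  simp only [pencilData_mat, pencilData_N] at h1
  have h2 : HasDerivAt (fun t : ℝ => (Gt.mat (q + t • v)).det * ∏ i, (ξ - lam i (q + t • v)))
      _ 0 := (Gt.hasDerivAt_det_mat q v).mul
    (HasDerivAt.fun_finsetProd fun i _ =>
      (hasDerivAt_line (h.differentiableAt hU hq i) v).const_sub ξ)
  have h3 := h1.unique (h2.congr_of_eventuallyEq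
    ((eventually_line hU hq v).mono fun t ht => h.roots _ ht ξ))
  -- With this form the term coming from the derivative of `det G̃` cancels the `G̃⁻¹Ñ` part of the
  -- left-hand side, and only `Ω` remains.
  have hadj : (Gt.mat q).adjugate = (Gt.mat q).det • (Gt.mat q)⁻¹ := by
    rw [inv_def, smul_smul, Ring.mul_inverse_cancel _ (isUnit_iff_ne_zero.2 hT), one_smul]
  rw [adjugate_mulVec_N hT, hadj, h.roots q hq] at h3
  simp only [zero_smul, add_zero, sub_dotProduct, smul_dotProduct, smul_mulVec,
    sum_dotProduct, smul_eq_mul, grad_dotProduct, mul_neg, Finset.sum_neg_distrib] at h3 ⊢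
  linarith

theorem finite_roots_compl_dense (y : Fin n → ℝ) : Dense (Set.range y)ᶜ :=
  (Set.finite_range y).countable.dense_compl ℝ

theorem IsRootFamily.det_ne_zero (h : IsRootFamily U G Gt lam) {q : Fin n → ℝ} (hq : q ∈ U)
    (hT : (Gt.mat q).det ≠ 0) {ξ : ℝ} (hξ : ξ ∉ Set.range fun i => lam i q) :
    (G.mat q + ξ • Gt.mat q).det ≠ 0 := by
  rw [h.roots q hq]
  exact mul_ne_zero hT (Finset.prod_ne_zero_iff.2 fun i _ =>
    sub_ne_zero.2 fun e => hξ ⟨i, e.symm⟩)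

/-- The Schur complement argument needs an invertible pencil. Both sides are continuous in `ξ` and
the non-roots are dense, so the identity extends to the roots, where it is used. -/
theorem IsRootFamily.borderedDet_eq (h : IsRootFamily U G Gt lam) {q : Fin n → ℝ} (hq : q ∈ U)
    (hT : (Gt.mat q).det ≠ 0) (ξ : ℝ) :
    (G.α + ξ * Gt.α) * (G.mat q + ξ • Gt.mat q).det - (G.N q + ξ • Gt.N q) ⬝ᵥ
      ((G.mat q + ξ • Gt.mat q).adjugate *ᵥ (G.N q + ξ • Gt.N q)) =
        (pencilData G Gt ξ).borderedDet := by
  have hc : Continuous fun ξ : ℝ => G.mat q + ξ • Gt.mat q := by fun_prop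
  have hv : Continuous fun ξ : ℝ => G.N q + ξ • Gt.N q := by fun_prop
  refine congrFun (Continuous.ext_on (finite_roots_compl_dense fun i => lam i q)
    (((by fun_prop : Continuous fun ξ : ℝ => G.α + ξ * Gt.α).mul hc.matrix_det).sub
      (hv.dotProduct (hc.matrix_adjugate.matrix_mulVec hv)))
    (contDiff_borderedDet_pencilData G Gt).continuous fun ξ hξ => ?_) ξ
  have := (pencilData G Gt ξ).borderedDet_eq q (by
    rw [pencilData_mat]; exact h.det_ne_zero hq hT hξ)
  rw [pencilData_mat, pencilData_N] at this
  exact this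

theorem IsRootFamily.det_eq_zero (h : IsRootFamily U G Gt lam) {q : Fin n → ℝ} (hq : q ∈ U)
    (a : Fin n) : (G.mat q + lam a q • Gt.mat q).det = 0 := by
  rw [h.roots q hq, Finset.prod_eq_zero (Finset.mem_univ a) (sub_self _), mul_zero]

/-- The denominator of `μ_a` is a function of `λ_a` alone. -/
theorem IsRootFamily.muDen_eq (h : IsRootFamily U G Gt lam) {q : Fin n → ℝ} (hq : q ∈ U)
    (hT : (Gt.mat q).det ≠ 0) (a : Fin n) :
    muDen G Gt lam a q = -(pencilData G Gt (lam a q)).borderedDet := by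
  rw [← h.borderedDet_eq hq hT, h.det_eq_zero hq, mul_zero, zero_sub, neg_neg, muDen]
  have h1 := adjugate_mulVec_N (G := G) hT (lam a q)
  have hs : (G.mat q + lam a q • Gt.mat q).adjugateᵀ = (G.mat q + lam a q • Gt.mat q).adjugate := by
    rw [← pencilData_mat, transpose_adjugate_mat]
  rw [h.det_eq_zero hq, zero_smul, zero_sub] at h1
  rw [h1, dotProduct_neg, dotProduct_mulVec (G.N q + _), ← mulVec_transpose, hs, h1,
    neg_dotProduct, neg_neg, dotProduct_comm]

end BiCofactor

/-! ### Simultaneous diagonalisation of the pencil by the differentials of the roots; distinctness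
of the roots. -/

namespace BiCofactor
open CofactorData
variable {n : ℕ} {U : Set (Fin n → ℝ)} {G Gt : CofactorData n} {lam : Fin n → (Fin n → ℝ) → ℝ}

/-- At a point with distinct roots `y`: the rows of `A` are the differentials of the roots of the
pencil `S + ξ T`, and `Ω` is the vector `Ω`. -/
structure RootFrame (S T A : Matrix (Fin n) (Fin n) ℝ) (y Ω : Fin n → ℝ) : Prop where
  symm_S : Sᵀ = S
  symm_T : Tᵀ = T
  det_T : T.det ≠ 0
  det_A : A.det ≠ 0
  inj : Function.Injective y
  roots : ∀ ξ : ℝ, (S + ξ • T).det = T.det * ∏ i, (ξ - y i)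
  adj : ∀ ξ : ℝ, (2 : ℝ) • ((S + ξ • T).adjugate *ᵥ Ω) =
    T.det • ∑ j, (∏ m ∈ Finset.univ.erase j, (ξ - y m)) • A.row j

namespace RootFrame
variable {S T A : Matrix (Fin n) (Fin n) ℝ} {y Ω : Fin n → ℝ}

theorem adjugate_mulVec (h : RootFrame S T A y Ω) (a : Fin n) :
    (S + y a • T).adjugate *ᵥ Ω = (T.det * Delta a y / 2) • A.row a := by
  have h1 := h.adj (y a)
  rw [Finset.sum_eq_single a (fun j _ hj => by rw [prod_erase_eval hj.symm, zero_smul])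
    (by simp)] at h1
  rw [show ∏ m ∈ Finset.univ.erase a, (y a - y m) = Delta a y from rfl, smul_smul] at h1
  rw [div_eq_inv_mul, mul_smul, ← h1, smul_smul]; norm_num

theorem det_eq_zero (h : RootFrame S T A y Ω) (a : Fin n) : (S + y a • T).det = 0 := by
  rw [h.roots, Finset.prod_eq_zero (Finset.mem_univ a) (sub_self _), mul_zero]

/-- Row `a` is a nonzero multiple of a vector in the image of the adjugate, and pencil times
adjugate is the determinant, which vanishes at a root. -/
theorem pencil_mulVec (h : RootFrame S T A y Ω) (a : Fin n) : (S + y a • T) *ᵥ A.row a = 0 := by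
  have h1 := congrArg ((S + y a • T) *ᵥ ·) (h.adjugate_mulVec a)
  simp only [mulVec_mulVec, mul_adjugate, h.det_eq_zero, zero_smul, zero_mulVec, mulVec_smul] at h1
  exact (smul_eq_zero.1 h1.symm).resolve_left
    (div_ne_zero (mul_ne_zero h.det_T (Delta_ne_zero h.inj a)) two_ne_zero)

theorem mulVec_eq (h : RootFrame S T A y Ω) (a : Fin n) :
    S *ᵥ A.row a = -(y a • (T *ᵥ A.row a)) := by
  have := h.pencil_mulVec a
  rw [add_mulVec, smul_mulVec] at this
  exact eq_neg_of_add_eq_zero_left this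

theorem mul_eq (h : RootFrame S T A y Ω) : A * S = -(diagonal y * (A * T)) := by
  ext a j
  have h1 := congrFun (h.mulVec_eq a) j
  rw [← h.symm_S, ← h.symm_T, mulVec_transpose, mulVec_transpose] at h1
  rw [neg_apply, diagonal_mul]; exact h1

/-- Eigenvectors of a symmetric pencil for different eigenvalues are orthogonal. -/
theorem dotProduct_eq_zero (h : RootFrame S T A y Ω) {a b : Fin n} (hab : a ≠ b) :
    A.row a ⬝ᵥ (T *ᵥ A.row b) = 0 := by
  have h1 : A.row a ⬝ᵥ (S *ᵥ A.row b) = (S *ᵥ A.row a) ⬝ᵥ A.row b := by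
    rw [dotProduct_mulVec, ← mulVec_transpose, h.symm_S]
  have h2 : A.row a ⬝ᵥ (T *ᵥ A.row b) = (T *ᵥ A.row a) ⬝ᵥ A.row b := by
    rw [dotProduct_mulVec, ← mulVec_transpose, h.symm_T]
  rw [h.mulVec_eq, h.mulVec_eq, dotProduct_neg, neg_dotProduct, dotProduct_smul, smul_dotProduct,
    ← h2, smul_eq_mul, smul_eq_mul] at h1
  have h3 : (y a - y b) * (A.row a ⬝ᵥ (T *ᵥ A.row b)) = 0 := by linarith
  exact (mul_eq_zero.1 h3).resolve_left (sub_ne_zero.2 fun e => hab (h.inj e))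

theorem mul_mul_transpose (h : RootFrame S T A y Ω) :
    A * T * Aᵀ = diagonal fun a => A.row a ⬝ᵥ (T *ᵥ A.row a) := by
  ext a b
  have : (A * T * Aᵀ) a b = A.row a ⬝ᵥ (T *ᵥ A.row b) := by
    rw [Matrix.mul_assoc, mul_apply]; rfl
  rw [this, diagonal_apply]
  split_ifs with e
  · rw [e]
  · exact h.dotProduct_eq_zero e

theorem dotProduct_ne_zero (h : RootFrame S T A y Ω) (a : Fin n) : A.row a ⬝ᵥ (T *ᵥ A.row a) ≠ 0 := by
  have h1 := congrArg det h.mul_mul_transpose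
  rw [det_mul, det_mul, det_transpose, det_diagonal] at h1
  exact Finset.prod_ne_zero_iff.1
    (h1 ▸ mul_ne_zero (mul_ne_zero h.det_A h.det_T) h.det_A) a (Finset.mem_univ a)

/-- Applying the pencil at a non-root `ξ` to `adj` turns the left side into a multiple of `Ω`. On
the right it restores the missing factor `ξ - y_j` in each summand, so the full product cancels. -/
theorem two_smul_eq (h : RootFrame S T A y Ω) : (2 : ℝ) • Ω = T *ᵥ ∑ j, A.row j := by
  obtain ⟨ξ, hξ⟩ := (Set.finite_range y).infinite_compl.nonempty
  have hp : ∏ i, (ξ - y i) ≠ 0 := Finset.prod_ne_zero_iff.2 fun i _ =>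
    sub_ne_zero.2 fun e => hξ ⟨i, e.symm⟩
  have h1 := congrArg ((S + ξ • T) *ᵥ ·) (h.adj ξ)
  simp only [mulVec_smul, mulVec_sum] at h1
  have h2 : ∀ j, (∏ m ∈ Finset.univ.erase j, (ξ - y m)) • ((S + ξ • T) *ᵥ A.row j) =
      (∏ i, (ξ - y i)) • (T *ᵥ A.row j) := fun j => by
    rw [add_mulVec, smul_mulVec, h.mulVec_eq, ← Finset.mul_prod_erase _ _ (Finset.mem_univ j),
      mul_comm, mul_smul, sub_smul]
    congr 1; abel
  simp only [h2] at h1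
  rw [mulVec_mulVec, mul_adjugate, h.roots, smul_mulVec, one_mulVec, ← Finset.smul_sum, smul_smul,
    smul_comm] at h1
  rw [mulVec_sum]
  refine smul_right_injective _ (mul_ne_zero h.det_T hp) ?_
  change (T.det * ∏ i, (ξ - y i)) • (2 : ℝ) • Ω = (T.det * ∏ i, (ξ - y i)) • _
  rw [smul_smul, mul_comm, h1, smul_smul, mul_comm]

theorem dotProduct_adjugate (h : RootFrame S T A y Ω) (a : Fin n) :
    Ω ⬝ᵥ ((S + y a • T).adjugate *ᵥ Ω) =
      T.det * Delta a y * (A.row a ⬝ᵥ (T *ᵥ A.row a)) / 4 := by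
  have h1 : A.row a ⬝ᵥ ((2 : ℝ) • Ω) = A.row a ⬝ᵥ (T *ᵥ A.row a) := by
    rw [h.two_smul_eq, mulVec_sum, dotProduct_sum, Finset.sum_eq_single a
      (fun j _ hj => h.dotProduct_eq_zero hj.symm) (by simp)]
  rw [h.adjugate_mulVec, dotProduct_smul, dotProduct_comm, ← h1, dotProduct_smul, smul_eq_mul,
    smul_eq_mul]
  ring

theorem dotProduct_adjugate_ne_zero (h : RootFrame S T A y Ω) (a : Fin n) :
    Ω ⬝ᵥ ((S + y a • T).adjugate *ᵥ Ω) ≠ 0 := by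
  rw [h.dotProduct_adjugate]
  exact div_ne_zero (mul_ne_zero (mul_ne_zero h.det_T (Delta_ne_zero h.inj a))
    (h.dotProduct_ne_zero a)) four_ne_zero

/-- `μ_a` is minus the component of `p` along `T A_a`. -/
theorem mu_eq (h : RootFrame S T A y Ω) (a : Fin n) (p : Fin n → ℝ) :
    -(1 / 2) * ((Ω ⬝ᵥ ((S + y a • T).adjugate *ᵥ p)) / (Ω ⬝ᵥ ((S + y a • T).adjugate *ᵥ Ω))) =
      -((A.row a ⬝ᵥ p) / (A.row a ⬝ᵥ (T *ᵥ A.row a))) := by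
  have hs : (S + y a • T).adjugateᵀ = (S + y a • T).adjugate := by
    rw [adjugate_transpose, transpose_add, transpose_smul, h.symm_S, h.symm_T]
  rw [h.dotProduct_adjugate, dotProduct_mulVec, ← mulVec_transpose, hs, h.adjugate_mulVec,
    smul_dotProduct, smul_eq_mul]
  have h1 := h.det_T
  have h2 := Delta_ne_zero h.inj a
  have h3 := h.dotProduct_ne_zero a
  field_simp
  ring

theorem det_pencil (h : RootFrame S T A y Ω) :
    (S.map C + (X : ℝ[X]) • T.map C).det = C T.det * ∏ j, ((X : ℝ[X]) - C (y j)) := by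
  refine Polynomial.funext fun ξ => ?_
  rw [eval_det, eval_mul, eval_C, eval_prod]
  simp only [eval_sub, eval_X, eval_C]
  rw [← h.roots]
  congr 1
  ext i j
  simp [mul_comm]

/-- Over `ℝ[X]` the pencil multiplies row `a` into `(X - y_a)` times its image under `T`. Applying
the adjugate and cancelling `X - y_a` is legitimate because `ℝ[X]` is a domain, so no inverse of the
pencil is needed. -/
theorem adjugate_pencil_mulVec (h : RootFrame S T A y Ω) (a : Fin n) :
    (S.map C + (X : ℝ[X]) • T.map C).adjugate *ᵥ (C ∘ (T *ᵥ A.row a)) =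
      (C T.det * ∏ j ∈ Finset.univ.erase a, ((X : ℝ[X]) - C (y j))) • (C ∘ A.row a) := by
  have hm : ∀ (R : Matrix (Fin n) (Fin n) ℝ) (v : Fin n → ℝ),
      R.map (C : ℝ →+* ℝ[X]) *ᵥ (C ∘ v) = C ∘ (R *ᵥ v) := fun R v => by
    ext1 i; exact ((C : ℝ →+* ℝ[X]).map_mulVec R v i).symm
  have h1 : (S.map C + (X : ℝ[X]) • T.map C) *ᵥ (C ∘ A.row a) =
      ((X : ℝ[X]) - C (y a)) • (C ∘ (T *ᵥ A.row a)) := by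
    rw [add_mulVec, smul_mulVec, hm, hm, h.mulVec_eq]
    ext1 i
    simp; ring
  have h2 := congrArg ((S.map C + (X : ℝ[X]) • T.map C).adjugate *ᵥ ·) h1
  simp only [mulVec_mulVec, adjugate_mul, mulVec_smul, smul_mulVec, one_mulVec] at h2
  rw [h.det_pencil, ← Finset.mul_prod_erase _ _ (Finset.mem_univ a), mul_left_comm, mul_smul] at h2
  exact (smul_right_injective _ (X_sub_C_ne_zero (y a)) h2).symm

theorem adjugate_coeff_mulVec (h : RootFrame S T A y Ω) (i : ℕ) (a : Fin n) :
    ((S.map C + (X : ℝ[X]) • T.map C).adjugate.map fun P => P.coeff i) *ᵥ (T *ᵥ A.row a) =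
      (T.det * prodCoeff (Finset.univ.erase a) i y) • A.row a := by
  ext r
  have h1 := congrArg (fun P : ℝ[X] => P.coeff i) (congrFun (h.adjugate_pencil_mulVec a) r)
  simp only [mulVec, dotProduct, Function.comp_apply, finsetSum_coeff, coeff_mul_C, Pi.smul_apply,
    smul_eq_mul, coeff_C_mul] at h1
  simpa [mulVec, dotProduct, prodCoeff] using h1

end RootFrame

/-- The Jacobian matrix of the roots. -/
noncomputable def rootJac (lam : Fin n → (Fin n → ℝ) → ℝ) (q : Fin n → ℝ) :
    Matrix (Fin n) (Fin n) ℝ :=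
  Matrix.of fun a => grad (lam a) q

theorem rootJac_det_ne_zero (h : FunctionallyIndependentOn U lam) {q : Fin n → ℝ} (hq : q ∈ U) :
    (rootJac lam q).det ≠ 0 := by
  let L : ((Fin n → ℝ) →L[ℝ] ℝ) →ₗ[ℝ] (Fin n → ℝ) :=
    { toFun := fun f i => f (Pi.single i 1)
      map_add' := fun f g => rfl
      map_smul' := fun c f => rfl }
  have hL : LinearMap.ker L = ⊥ := LinearMap.ker_eq_bot'.2 fun f hf => by
    refine ContinuousLinearMap.ext fun v => ?_
    rw [pi_eq_sum_univ' v, map_sum]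
    simp only [map_smul]
    exact Finset.sum_eq_zero fun i _ => by rw [show f (Pi.single i 1) = 0 from congrFun hf i]; simp
  have h1 : LinearIndependent ℝ (rootJac lam q).row := (h q hq).map' L hL
  exact ((isUnit_iff_isUnit_det _).1 (linearIndependent_rows_iff_isUnit.1 h1)).ne_zero

theorem IsRootFamily.rootFrame (h : IsRootFamily U G Gt lam) (hU : IsOpen U)
    (hi : FunctionallyIndependentOn U lam) {q : Fin n → ℝ} (hq : q ∈ U)
    (hT : (Gt.mat q).det ≠ 0) (hinj : Function.Injective fun i => lam i q) :
    RootFrame (G.mat q) (Gt.mat q) (rootJac lam q) (fun i => lam i q) (Om G Gt q) where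
  symm_S := G.transpose_mat q
  symm_T := Gt.transpose_mat q
  det_T := hT
  det_A := rootJac_det_ne_zero hi hq
  inj := hinj
  roots := h.roots q hq
  adj := h.adjugate_mulVec_Om hU hq hT

/-- The derivative of the vector of roots, as an isomorphism. -/
theorem IsRootFamily.exists_equiv (h : IsRootFamily U G Gt lam) (hU : IsOpen U)
    (hi : FunctionallyIndependentOn U lam) {q : Fin n → ℝ} (hq : q ∈ U) :
    ∃ f' : (Fin n → ℝ) ≃L[ℝ] (Fin n → ℝ),
      HasFDerivAt (fun q i => lam i q) (f' : (Fin n → ℝ) →L[ℝ] (Fin n → ℝ)) q := by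
  have hA : IsUnit (rootJac lam q).det := isUnit_iff_ne_zero.2 (rootJac_det_ne_zero hi hq)
  refine ⟨(Matrix.toLinearEquiv' (rootJac lam q)
    (invertibleOfIsUnitDet _ hA)).toContinuousLinearEquiv, hasFDerivAt_pi'.2 fun i => ?_⟩
  refine (h.differentiableAt hU hq i).hasFDerivAt.congr_fderiv (ContinuousLinearMap.ext fun v => ?_)
  rw [← grad_dotProduct]; rfl

theorem IsRootFamily.contDiffAt (h : IsRootFamily U G Gt lam) (hU : IsOpen U)
    {q : Fin n → ℝ} (hq : q ∈ U) : ContDiffAt ℝ ∞ (fun q i => lam i q) q :=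
  contDiffAt_pi.2 fun i => (h.smooth i).contDiffAt (hU.mem_nhds hq)

/-- A double root makes every summand of `adjugate_mulVec_Om` vanish, hence `W(λ_i) = 0`, where `W`
is the bordered determinant of the pencil. Moving to a nearby point with the same `λ_i` but distinct
roots contradicts the nonvanishing of the denominator there. -/
theorem IsRootFamily.injective (h : IsRootFamily U G Gt lam) (hU : IsOpen U)
    (hi : FunctionallyIndependentOn U lam) (hT : ∀ q ∈ U, (Gt.mat q).det ≠ 0)
    {q : Fin n → ℝ} (hq : q ∈ U) : Function.Injective fun i => lam i q := by
  intro i j hij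
  by_contra hne
  have hW : (pencilData G Gt (lam i q)).borderedDet = 0 := by
    have h1 : muDen G Gt lam i q = 0 := by
      have h2 := h.adjugate_mulVec_Om hU hq (hT q hq) (lam i q)
      rw [Finset.sum_eq_zero, smul_zero] at h2
      · rw [muDen, (smul_eq_zero.1 h2).resolve_left two_ne_zero, dotProduct_zero]
      · intro m _
        rw [Finset.prod_eq_zero (i := if m = i then j else i), zero_smul]
        · split_ifs with e
          · simp [e, Ne.symm hne]
          · simp [Ne.symm e]
        · split_ifs
          · exact sub_eq_zero.2 hij
          · exact sub_self _
    rw [h.muDen_eq hq (hT q hq)] at h1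
    exact neg_eq_zero.1 h1
  obtain ⟨f', hf'⟩ := h.exists_equiv hU hi hq
  have hmap := ((h.contDiffAt hU hq).hasStrictFDerivAt' hf' (by simp)).map_nhds_eq_of_equiv
  have himg : (fun q i => lam i q) '' U ∈ nhds fun i => lam i q := by
    rw [← hmap]; exact Filter.image_mem_map (hU.mem_nhds hq)
  -- A direction in root space with pairwise distinct velocities that leaves the `i`-th root fixed.
  let w : Fin n → ℝ := fun m => (m : ℝ) - (i : ℝ)
  have hcont : ContinuousAt (fun t : ℝ => (fun i => lam i q) + t • w) 0 := by fun_prop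
  have hev1 : ∀ᶠ t : ℝ in nhdsWithin 0 {0}ᶜ,
      (fun i => lam i q) + t • w ∈ (fun q i => lam i q) '' U :=
    nhdsWithin_le_nhds (hcont.preimage_mem_nhds (by simpa using himg))
  have hev2 : ∀ᶠ t : ℝ in nhdsWithin 0 {0}ᶜ, ∀ a b : Fin n, a ≠ b →
      lam a q + t * w a ≠ lam b q + t * w b := by
    refine Filter.eventually_all.2 fun a => Filter.eventually_all.2 fun b => ?_
    by_cases hab : a = b
    · simp [hab]
    by_cases hl : lam a q = lam b q
    · filter_upwards [self_mem_nhdsWithin] with t ht _ he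
      rw [hl] at he
      have : t * ((a : ℝ) - (b : ℝ)) = 0 := by simp only [w] at he; linarith
      rcases mul_eq_zero.1 this with h0 | h0
      · exact ht h0
      · exact hab (Fin.ext (by exact_mod_cast sub_eq_zero.1 h0))
    · have hc : ContinuousAt (fun t : ℝ => (lam a q + t * w a) - (lam b q + t * w b)) 0 := by
        fun_prop
      have := hc.eventually_ne (y := 0) (by simpa using sub_ne_zero.2 hl)
      exact (this.filter_mono nhdsWithin_le_nhds).mono fun t ht _ he => ht (sub_eq_zero.2 he)
  obtain ⟨t, ⟨q', hq', he⟩, hd⟩ := (hev1.and hev2).exists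
  have he' : ∀ m, lam m q' = lam m q + t * w m := fun m => congrFun he m
  have hinj : Function.Injective fun i => lam i q' := fun a b hab => by
    by_contra hne
    refine hd a b hne ?_
    rw [← he', ← he']; exact hab
  have hi' : lam i q' = lam i q := by rw [he']; simp [w]
  have := (h.rootFrame hU hi hq' (hT q' hq') hinj).dotProduct_adjugate_ne_zero i
  rw [← muDen, h.muDen_eq hq' (hT q' hq'), hi', hW] at this
  simp at this

end BiCofactor

/-! ### The charts `λ` and `(λ, μ, c')`. -/

namespace BiCofactor
open CofactorData
variable {n : ℕ} {U V : Set (Fin n → ℝ)} {G Gt : CofactorData n}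
  {lam : Fin n → (Fin n → ℝ) → ℝ}

/-- A chart whose coordinates are the roots of the pencil, with a box as its image. -/
structure IsRootChart (G Gt : CofactorData n) (lam : Fin n → (Fin n → ℝ) → ℝ)
    (V : Set (Fin n → ℝ)) (e : OpenPartialHomeomorph (Fin n → ℝ) (Fin n → ℝ)) : Prop where
  source : e.source = V
  coe : ∀ q ∈ V, e q = fun i => lam i q
  smooth_symm : ContDiffOn ℝ ∞ e.symm e.target
  target : ∃ y₀ r, e.target = Metric.ball y₀ r
  family : IsRootFamily V G Gt lam
  frame : ∀ q ∈ V,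
    RootFrame (G.mat q) (Gt.mat q) (rootJac lam q) (fun i => lam i q) (Om G Gt q)

theorem IsRootFamily.mono (h : IsRootFamily U G Gt lam) (hV : V ⊆ U) :
    IsRootFamily V G Gt lam :=
  ⟨fun i => (h.smooth i).mono hV, fun q hq => h.roots q (hV hq)⟩

theorem IsRootFamily.exists_chart (h : IsRootFamily U G Gt lam) (hU : IsOpen U)
    (hi : FunctionallyIndependentOn U lam) (hT : ∀ q ∈ U, (Gt.mat q).det ≠ 0)
    {q₀ : Fin n → ℝ} (hq₀ : q₀ ∈ U) :
    ∃ V ⊆ U, q₀ ∈ V ∧ ∃ e, IsRootChart G Gt lam V e := by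
  obtain ⟨f', hf'⟩ := h.exists_equiv hU hi hq₀
  set e₁ := ((h.contDiffAt hU hq₀).toOpenPartialHomeomorph _ hf' (by simp)).restrOpen U hU with he₁
  have hcoe : ∀ q, e₁ q = fun i => lam i q := fun q => rfl
  have hsub : e₁.source ⊆ U := fun q hq => by
    rw [he₁, OpenPartialHomeomorph.restrOpen_source] at hq; exact hq.2
  have hmem : q₀ ∈ e₁.source := by
    rw [he₁, OpenPartialHomeomorph.restrOpen_source]
    exact ⟨ContDiffAt.mem_toOpenPartialHomeomorph_source _ _ _, hq₀⟩
  -- A ball of the sup metric is a convex box. Convexity serves to integrate closed forms, the box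
  -- shape to vary one root at a time.
  obtain ⟨r, hr, hball⟩ := Metric.isOpen_iff.1 e₁.open_target _ (e₁.map_source hmem)
  set e := (e₁.symm.restrOpen (Metric.ball (e₁ q₀) r) Metric.isOpen_ball).symm with he
  have hs : e.source ⊆ e₁.source := fun q hq => hq.1
  have ht : e.target = Metric.ball (e₁ q₀) r := by
    rw [he, OpenPartialHomeomorph.symm_target, OpenPartialHomeomorph.restrOpen_source,
      OpenPartialHomeomorph.symm_source, Set.inter_eq_right.2 hball]
  have hsU : e.source ⊆ U := hs.trans hsub
  refine ⟨e.source, hsU, ?_, e, rfl, fun q _ => hcoe q, fun y hy => ?_, ⟨_, _, ht⟩, h.mono hsU,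
    fun q hq => h.rootFrame hU hi (hsU hq) (hT q (hsU hq)) (h.injective hU hi hT (hsU hq))⟩
  · refine ⟨hmem, ?_⟩
    simpa using hr
  · have hy' := hsU (e.map_target hy)
    obtain ⟨g', hg'⟩ := h.exists_equiv hU hi hy'
    exact (e.contDiffAt_symm hy hg' (h.contDiffAt hU hy')).contDiffWithinAt

/-- The covector `w = ∑ μ_a dλ_a`. -/
noncomputable def rootCovector (lam : Fin n → (Fin n → ℝ) → ℝ) (q m : Fin n → ℝ) : Fin n → ℝ :=
  (rootJac lam q)ᵀ *ᵥ m

theorem rootCovector_apply (q m : Fin n → ℝ) (j : Fin n) :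
    rootCovector lam q m j = ∑ a, m a * grad (lam a) q j := by
  simp only [rootCovector, mulVec, dotProduct, transpose_apply, mul_comm]; rfl

/-- The map `(q, μ, c') ↦ (q, p, c)`. -/
noncomputable def phaseOfRoot (Gt : CofactorData n) (lam : Fin n → (Fin n → ℝ) → ℝ)
    (x : Phase n) : Phase n :=
  (x.1, -(Gt.mat x.1 *ᵥ rootCovector lam x.1 x.2.1), -x.2.2 / (2 * (Gt.mat x.1).det))

theorem contDiffOn_grad {f : (Fin n → ℝ) → ℝ} (hV : IsOpen V) (hf : ContDiffOn ℝ ∞ f V)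
    (j : Fin n) : ContDiffOn ℝ ∞ (fun q => grad f q j) V :=
  (hf.fderiv_of_isOpen hV (by simp)).clm_apply contDiffOn_const

namespace RootFrame
variable {S T A : Matrix (Fin n) (Fin n) ℝ} {y Ω : Fin n → ℝ}

theorem mulVec_mulVec_transpose (h : RootFrame S T A y Ω) (m : Fin n → ℝ) (a : Fin n) :
    A.row a ⬝ᵥ (T *ᵥ (Aᵀ *ᵥ m)) = (A.row a ⬝ᵥ (T *ᵥ A.row a)) * m a := by
  have h1 := congrFun (congrArg (· *ᵥ m) h.mul_mul_transpose) a
  simp only [← mulVec_mulVec, mulVec_diagonal] at h1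
  exact h1

theorem eq_of_row_dotProduct (h : RootFrame S T A y Ω) {u v : Fin n → ℝ}
    (huv : ∀ a, A.row a ⬝ᵥ u = A.row a ⬝ᵥ v) : u = v := by
  have := h.det_A
  exact mulVec_injective_of_isUnit ((isUnit_iff_isUnit_det A).2 (isUnit_iff_ne_zero.2 this))
    (funext huv)

end RootFrame

namespace IsRootChart
variable {e : OpenPartialHomeomorph (Fin n → ℝ) (Fin n → ℝ)}

theorem isOpen (h : IsRootChart G Gt lam V e) : IsOpen V := h.source ▸ e.open_source

theorem symm_mem (h : IsRootChart G Gt lam V e) {y : Fin n → ℝ} (hy : y ∈ e.target) :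
    e.symm y ∈ V := h.source ▸ e.map_target hy

theorem lam_symm (h : IsRootChart G Gt lam V e) {y : Fin n → ℝ} (hy : y ∈ e.target) :
    (fun i => lam i (e.symm y)) = y := by
  rw [← h.coe _ (h.symm_mem hy), e.right_inv hy]

theorem lam_mem (h : IsRootChart G Gt lam V e) {q : Fin n → ℝ} (hq : q ∈ V) :
    (fun i => lam i q) ∈ e.target := by
  rw [← h.coe q hq]; exact e.map_source (h.source ▸ hq)

theorem symm_lam (h : IsRootChart G Gt lam V e) {q : Fin n → ℝ} (hq : q ∈ V) :
    e.symm (fun i => lam i q) = q := by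
  rw [← h.coe q hq]; exact e.left_inv (h.source ▸ hq)

theorem mu_eq (h : IsRootChart G Gt lam V e) {q : Fin n → ℝ} (hq : q ∈ V) (a : Fin n)
    (p : Fin n → ℝ) : mu G Gt lam a q p =
      -((grad (lam a) q ⬝ᵥ p) / (grad (lam a) q ⬝ᵥ (Gt.mat q *ᵥ grad (lam a) q))) :=
  (h.frame q hq).mu_eq a p

/-- Pairing with each `∇λ_a` suffices, and there `G̃`-orthogonality leaves only the `a`-th term. The
relation replaces the explicit quotient for `μ` in all later differentiations. -/
theorem mulVec_rootCovector_mu (h : IsRootChart G Gt lam V e) {q : Fin n → ℝ} (hq : q ∈ V)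
    (p : Fin n → ℝ) :
    Gt.mat q *ᵥ rootCovector lam q (fun a => mu G Gt lam a q p) = -p := by
  refine (h.frame q hq).eq_of_row_dotProduct fun a => ?_
  rw [rootCovector, (h.frame q hq).mulVec_mulVec_transpose, h.mu_eq hq, dotProduct_neg]
  have := (h.frame q hq).dotProduct_ne_zero a
  change (grad (lam a) q ⬝ᵥ (Gt.mat q *ᵥ grad (lam a) q)) * _ = -(grad (lam a) q ⬝ᵥ p)
  change grad (lam a) q ⬝ᵥ (Gt.mat q *ᵥ grad (lam a) q) ≠ 0 at this
  field_simp

theorem mu_rootCovector (h : IsRootChart G Gt lam V e) {q : Fin n → ℝ} (hq : q ∈ V)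
    (m : Fin n → ℝ) (a : Fin n) :
    mu G Gt lam a q (-(Gt.mat q *ᵥ rootCovector lam q m)) = m a := by
  have h1 := (h.frame q hq).dotProduct_ne_zero a
  have h2 := (h.frame q hq).mulVec_mulVec_transpose m a
  rw [h.mu_eq hq, dotProduct_neg, neg_div, neg_neg]
  exact (div_eq_iff h1).2 (h2.trans (mul_comm _ _))

theorem contDiffOn_dnMap (h : IsRootChart G Gt lam V e) :
    ContDiffOn ℝ ∞ (dnMap G Gt lam) (V ×ˢ Set.univ) := by
  have hfst : ContDiffOn ℝ ∞ (fun x : Phase n => x.1) (V ×ˢ Set.univ) := contDiff_fst.contDiffOn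
  have hm : Set.MapsTo (fun x : Phase n => x.1) (V ×ˢ Set.univ) V := fun x hx => hx.1
  have hg : ∀ a j, ContDiffOn ℝ ∞ (fun x : Phase n => grad (lam a) x.1 j) (V ×ˢ Set.univ) :=
    fun a j => (contDiffOn_grad h.isOpen (h.family.smooth a) j).comp hfst hm
  refine (contDiffOn_pi.2 fun i => (h.family.smooth i).comp hfst hm).prodMk
    ((contDiffOn_pi.2 fun a => ?_).prodMk ?_)
  · refine ContDiffOn.congr (f := fun x : Phase n => -((grad (lam a) x.1 ⬝ᵥ x.2.1) /
      (grad (lam a) x.1 ⬝ᵥ (Gt.mat x.1 *ᵥ grad (lam a) x.1)))) (ContDiffOn.neg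
        (ContDiffOn.div ?_ ?_ fun x hx => ?_)) fun x hx => h.mu_eq hx.1 a _
    · simp only [dotProduct]
      exact ContDiffOn.sum fun j _ => (hg a j).mul (by fun_prop)
    · simp only [dotProduct, mulVec]
      exact ContDiffOn.sum fun j _ => (hg a j).mul (ContDiffOn.sum fun k _ =>
        ((Gt.contDiff_mat_apply j k).comp contDiff_fst).contDiffOn.mul (hg a k))
    · exact (h.frame _ hx.1).dotProduct_ne_zero a
  · exact ContDiffOn.mul (by fun_prop) (Gt.contDiff_det.comp contDiff_fst).contDiffOn

theorem contDiffOn_phaseOfRoot (h : IsRootChart G Gt lam V e) :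
    ContDiffOn ℝ ∞ (phaseOfRoot Gt lam) (V ×ˢ Set.univ) := by
  have hfst : ContDiffOn ℝ ∞ (fun x : Phase n => x.1) (V ×ˢ Set.univ) := contDiff_fst.contDiffOn
  have hm : Set.MapsTo (fun x : Phase n => x.1) (V ×ˢ Set.univ) V := fun x hx => hx.1
  have hg : ∀ a j, ContDiffOn ℝ ∞ (fun x : Phase n => grad (lam a) x.1 j) (V ×ˢ Set.univ) :=
    fun a j => (contDiffOn_grad h.isOpen (h.family.smooth a) j).comp hfst hm
  refine hfst.prodMk ((contDiffOn_pi.2 fun i => ?_).prodMk ?_)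
  · simp only [Pi.neg_apply, mulVec, dotProduct, rootCovector_apply]
    exact (ContDiffOn.sum fun j _ => ((Gt.contDiff_mat_apply i j).comp contDiff_fst).contDiffOn.mul
      (ContDiffOn.sum fun a _ => ContDiffOn.mul (by fun_prop) (hg a j))).neg
  · exact ContDiffOn.div (by fun_prop)
      (contDiff_const.mul (Gt.contDiff_det.comp contDiff_fst)).contDiffOn
      fun x hx => mul_ne_zero two_ne_zero (h.frame _ hx.1).det_T

/-- The map from `(λ, μ, c')` to `(q, μ, c')` is smooth. -/
theorem contDiffOn_symm_fst (h : IsRootChart G Gt lam V e) :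
    ContDiffOn ℝ ∞ (fun z : Phase n => ((e.symm z.1, z.2) : Phase n)) (e.target ×ˢ Set.univ) :=
  (h.smooth_symm.comp contDiff_fst.contDiffOn fun _ hx => hx.1).prodMk contDiff_snd.contDiffOn

theorem contDiffOn_dnInv (h : IsRootChart G Gt lam V e) :
    ContDiffOn ℝ ∞ (fun z : Phase n => phaseOfRoot Gt lam (e.symm z.1, z.2))
      (e.target ×ˢ Set.univ) :=
  h.contDiffOn_phaseOfRoot.comp h.contDiffOn_symm_fst fun _ hx => ⟨h.symm_mem hx.1, trivial⟩

theorem dnMap_phaseOfRoot (h : IsRootChart G Gt lam V e) {x : Phase n} (hx : x.1 ∈ V) :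
    dnMap G Gt lam (phaseOfRoot Gt lam x) = (fun i => lam i x.1, x.2) := by
  obtain ⟨q, m, c⟩ := x
  have hT := (h.frame q hx).det_T
  refine Prod.ext rfl (Prod.ext (funext fun a => h.mu_rootCovector hx m a) ?_)
  change -2 * (-c / (2 * (Gt.mat q).det)) * (Gt.mat q).det = c
  field_simp

theorem phaseOfRoot_dnMap (h : IsRootChart G Gt lam V e) {x : Phase n} (hx : x.1 ∈ V) :
    phaseOfRoot Gt lam (x.1, (dnMap G Gt lam x).2) = x := by
  obtain ⟨q, p, c⟩ := x
  have hT := (h.frame q hx).det_T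
  refine Prod.ext rfl (Prod.ext ?_ ?_)
  · change -(Gt.mat q *ᵥ rootCovector lam q (fun a => mu G Gt lam a q p)) = p
    rw [h.mulVec_rootCovector_mu hx, neg_neg]
  · change -(-2 * c * (Gt.mat q).det) / (2 * (Gt.mat q).det) = c
    field_simp

/-- The coordinates `(λ, μ, c')` as a local homeomorphism. -/
noncomputable def phaseChart (h : IsRootChart G Gt lam V e) :
    OpenPartialHomeomorph (Phase n) (Phase n) where
  toFun := dnMap G Gt lam
  invFun z := phaseOfRoot Gt lam (e.symm z.1, z.2)
  source := V ×ˢ Set.univ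
  target := e.target ×ˢ Set.univ
  map_source' x hx := ⟨h.lam_mem hx.1, trivial⟩
  map_target' z hz := ⟨h.symm_mem hz.1, trivial⟩
  left_inv' x hx := by
    change phaseOfRoot Gt lam (e.symm (fun i => lam i x.1), _) = x
    rw [h.symm_lam hx.1]; exact h.phaseOfRoot_dnMap hx.1
  right_inv' z hz := by
    rw [h.dnMap_phaseOfRoot (h.symm_mem hz.1)]
    exact Prod.ext (h.lam_symm hz.1) rfl
  open_source := h.isOpen.prod isOpen_univ
  open_target := e.open_target.prod isOpen_univ
  continuousOn_toFun := h.contDiffOn_dnMap.continuousOn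
  continuousOn_invFun := h.contDiffOn_dnInv.continuousOn

end IsRootChart
end BiCofactor

/-! ### Congruence of bordered skew-symmetric matrices. -/

namespace BiCofactor
variable {n : ℕ}

/-- Skewness of `S` kills the corner term `uᵀSu`, and the two mixed corner terms `uᵀv` cancel, so
the bordered shape survives. -/
theorem transform_bordered {S J : Matrix (Fin n ⊕ Fin n) (Fin n ⊕ Fin n) ℝ} (hS : Sᵀ = -S)
    (u v : Fin n ⊕ Fin n → ℝ) (c : ℝ) :
    fromBlocks J 0 (replicateRow Unit u) (c • (1 : Matrix Unit Unit ℝ)) * bordered S v *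
      (fromBlocks J 0 (replicateRow Unit u) (c • (1 : Matrix Unit Unit ℝ)))ᵀ =
    bordered (J * S * Jᵀ) (J *ᵥ (S *ᵥ u) + c • (J *ᵥ v)) := by
  have h0 : u ⬝ᵥ (S *ᵥ u) = 0 := by
    have : u ⬝ᵥ (S *ᵥ u) = -(u ⬝ᵥ (S *ᵥ u)) := by
      conv_lhs => rw [dotProduct_mulVec, ← mulVec_transpose, hS, neg_mulVec, neg_dotProduct,
        dotProduct_comm]
    linarith
  have h12 : J * S * replicateCol Unit u + c • (J * replicateCol Unit v) =
      replicateCol Unit (J *ᵥ (S *ᵥ u) + c • (J *ᵥ v)) := by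
    rw [mulVec_mulVec]; rfl
  rw [bordered, bordered, fromBlocks_transpose, fromBlocks_multiply, fromBlocks_multiply]
  congr 1
  · simp
  · rw [← h12]; simp [Matrix.mul_assoc]
  · have h21 := congrArg transpose h12
    rw [transpose_add, transpose_mul, transpose_mul, transpose_smul, transpose_mul, hS] at h21
    rw [show replicateRow Unit (J *ᵥ (S *ᵥ u) + c • (J *ᵥ v)) = _ from h21.symm]
    simp only [transpose_replicateCol]
    simp [Matrix.add_mul, Matrix.mul_assoc, add_comm]
  · have e1 : replicateRow Unit u * (S * replicateCol Unit u) = 0 := by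
      ext i k; exact h0
    have e2 : replicateRow Unit v * replicateCol Unit u =
        replicateRow Unit u * replicateCol Unit v := by
      ext i k; exact dotProduct_comm _ _
    simp [Matrix.add_mul, Matrix.mul_assoc, e1, e2]

/-- The Jacobian shape expresses that `λ` depends on `q`, `μ` on `(q, p)`, and `c'` on `(q, c)`.
Writing `∂μ/∂q` as `C * K` pulls `C` out of the lower blocks. -/
theorem transform_blocks {A C K R Q : Matrix (Fin n) (Fin n) ℝ} (hR : Rᵀ = R) (hQ : Qᵀ = -Q)
    (d v₁ v₂ : Fin n → ℝ) (c : ℝ) :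
    fromBlocks (fromBlocks A 0 (C * K) C) 0 (replicateRow Unit (Sum.elim d 0)) (c • (1 : Matrix Unit Unit ℝ)) *
      bordered (fromBlocks 0 R (-R) Q) (Sum.elim v₁ v₂) *
      (fromBlocks (fromBlocks A 0 (C * K) C) 0 (replicateRow Unit (Sum.elim d 0))
        (c • (1 : Matrix Unit Unit ℝ)))ᵀ =
    bordered (fromBlocks 0 (A * R * Cᵀ) (-(A * R * Cᵀ)ᵀ) (C * (K * R - R * Kᵀ + Q) * Cᵀ))
      (Sum.elim (c • (A *ᵥ v₁)) (C *ᵥ (-(R *ᵥ d) + c • (K *ᵥ v₁ + v₂)))) := by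
  rw [transform_bordered (by
    rw [fromBlocks_transpose, fromBlocks_neg, hQ, transpose_neg, hR]; simp)]
  congr 1
  · rw [fromBlocks_transpose, fromBlocks_multiply, fromBlocks_multiply]
    congr 1
    · simp
    · simp
    · simp [hR, Matrix.mul_assoc]
    · simp only [transpose_mul, Matrix.mul_add, Matrix.mul_sub, Matrix.add_mul, Matrix.sub_mul,
        Matrix.mul_neg, Matrix.neg_mul, Matrix.mul_zero, zero_add, Matrix.mul_assoc]
      abel
  · rw [fromBlocks_mulVec, fromBlocks_mulVec, fromBlocks_mulVec]
    ext i
    rcases i with i | i <;>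
      simp [mulVec_add, mulVec_neg, mulVec_smul, neg_mulVec, ← mulVec_mulVec, mul_add]

end BiCofactor

/-! ### Hessians of the roots and the differentiated eigenvalue equation. -/

namespace BiCofactor
open CofactorData
variable {n : ℕ} {V : Set (Fin n → ℝ)} {G Gt : CofactorData n}
  {lam : Fin n → (Fin n → ℝ) → ℝ} {e : OpenPartialHomeomorph (Fin n → ℝ) (Fin n → ℝ)}

/-- The Hessian matrix of a function of `q`. -/
noncomputable def hess (f : (Fin n → ℝ) → ℝ) (q : Fin n → ℝ) : Matrix (Fin n) (Fin n) ℝ :=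
  Matrix.of fun j => grad (fun q => grad f q j) q

theorem transpose_hess {f : (Fin n → ℝ) → ℝ} (hV : IsOpen V) (hf : ContDiffOn ℝ ∞ f V)
    {q : Fin n → ℝ} (hq : q ∈ V) : (hess f q)ᵀ = hess f q := by
  have hc := hf.contDiffAt (hV.mem_nhds hq)
  have hd : DifferentiableAt ℝ (fderiv ℝ f) q :=
    (hc.fderiv_right (m := ∞) (by simp)).differentiableAt (by simp)
  have hs : IsSymmSndFDerivAt ℝ f q := hc.isSymmSndFDerivAt (by
    rw [minSmoothness_of_isRCLikeNormedField]; exact WithTop.coe_le_coe.2 le_top)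
  have key : ∀ j k, hess f q j k = fderiv ℝ (fderiv ℝ f) q (Pi.single k 1) (Pi.single j 1) := by
    intro j k
    change fderiv ℝ (fun q => fderiv ℝ f q (Pi.single j 1)) q (Pi.single k 1) = _
    rw [fderiv_clm_apply hd (differentiableAt_const _)]
    simp
  ext j k
  rw [transpose_apply, key, key, hs.eq]

theorem differentiableAt_grad {f : (Fin n → ℝ) → ℝ} (hV : IsOpen V) (hf : ContDiffOn ℝ ∞ f V)
    {q : Fin n → ℝ} (hq : q ∈ V) (j : Fin n) : DifferentiableAt ℝ (fun q => grad f q j) q :=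
  ((contDiffOn_grad hV hf j).contDiffAt (hV.mem_nhds hq)).differentiableAt (by simp)

theorem hasDerivAt_grad {f : (Fin n → ℝ) → ℝ} (hV : IsOpen V) (hf : ContDiffOn ℝ ∞ f V)
    {q : Fin n → ℝ} (hq : q ∈ V) (v : Fin n → ℝ) :
    HasDerivAt (fun t : ℝ => grad f (q + t • v)) (hess f q *ᵥ v) 0 :=
  hasDerivAt_pi.2 fun j => (hasDerivAt_line (differentiableAt_grad hV hf hq j) v).congr_deriv
    (grad_dotProduct _ q v).symm

theorem hasDerivAt_dotProduct {x y : ℝ → Fin n → ℝ} {x' y' : Fin n → ℝ} {t : ℝ}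
    (hx : HasDerivAt x x' t) (hy : HasDerivAt y y' t) :
    HasDerivAt (fun s => x s ⬝ᵥ y s) (x' ⬝ᵥ y t + x t ⬝ᵥ y') t := by
  refine (HasDerivAt.fun_sum fun i _ => (hasDerivAt_pi.1 hx i).mul
    (hasDerivAt_pi.1 hy i)).congr_deriv ?_
  rw [Finset.sum_add_distrib]; rfl

theorem hasDerivAt_mat_mulVec (D : CofactorData n) {q v : Fin n → ℝ} {x : ℝ → Fin n → ℝ}
    {x' : Fin n → ℝ} (hx : HasDerivAt x x' 0) :
    HasDerivAt (fun t : ℝ => D.mat (q + t • v) *ᵥ x t)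
      ((x 0 ⬝ᵥ v) • D.N q + (D.N q ⬝ᵥ x 0) • v + D.mat q *ᵥ x') 0 := by
  refine hasDerivAt_pi.2 fun i => ?_
  refine HasDerivAt.congr_deriv (f := fun t : ℝ => ∑ j, D.mat (q + t • v) i j * x t j)
    (HasDerivAt.fun_sum fun j _ => (D.hasDerivAt_mat q v i j).mul (hasDerivAt_pi.1 hx j)) ?_
  simp only [Pi.add_apply, Pi.smul_apply, smul_eq_mul, mulVec, dotProduct, Finset.sum_mul,
    zero_smul, add_zero, ← Finset.sum_add_distrib]
  exact Finset.sum_congr rfl fun j _ => by ring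

/-- The Hessian matrix of `∑ m_a λ_a`. -/
noncomputable def rootHess (lam : Fin n → (Fin n → ℝ) → ℝ) (q m : Fin n → ℝ) :
    Matrix (Fin n) (Fin n) ℝ :=
  ∑ a, m a • hess (lam a) q

theorem rootCovector_eq_sum (q m : Fin n → ℝ) :
    rootCovector lam q m = ∑ a, m a • grad (lam a) q := by
  ext j; simp [rootCovector_apply]

theorem hasDerivAt_rootCovector (hV : IsOpen V) (hl : ∀ a, ContDiffOn ℝ ∞ (lam a) V)
    {q v : Fin n → ℝ} (hq : q ∈ V) {m : ℝ → Fin n → ℝ} {m' : Fin n → ℝ}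
    (hm : HasDerivAt m m' 0) :
    HasDerivAt (fun t : ℝ => rootCovector lam (q + t • v) (m t))
      (rootHess lam q (m 0) *ᵥ v + rootCovector lam q m') 0 := by
  simp only [rootCovector_eq_sum]
  refine (HasDerivAt.fun_sum fun a _ => (hasDerivAt_pi.1 hm a).smul
    (hasDerivAt_grad hV (hl a) hq v)).congr_deriv ?_
  rw [Finset.sum_add_distrib, rootHess, sum_mulVec]
  simp [smul_mulVec]

namespace IsRootChart

theorem transpose_rootHess (h : IsRootChart G Gt lam V e) {q : Fin n → ℝ} (hq : q ∈ V)
    (m : Fin n → ℝ) : (rootHess lam q m)ᵀ = rootHess lam q m := by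
  simp [rootHess, transpose_sum, transpose_hess h.isOpen (h.family.smooth _) hq]

/-- The derivative of the eigenvalue equation `(G + λ_a G̃) ∇λ_a = 0`. -/
theorem deriv_pencil_mulVec (h : IsRootChart G Gt lam V e) {q : Fin n → ℝ} (hq : q ∈ V)
    (a : Fin n) :
    vecMulVec (G.N q + lam a q • Gt.N q) (grad (lam a) q) +
      ((G.N q + lam a q • Gt.N q) ⬝ᵥ grad (lam a) q) • (1 : Matrix (Fin n) (Fin n) ℝ) +
      vecMulVec (Gt.mat q *ᵥ grad (lam a) q) (grad (lam a) q) +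
      (G.mat q + lam a q • Gt.mat q) * hess (lam a) q = 0 := by
  have key : ∀ v, (vecMulVec (G.N q + lam a q • Gt.N q) (grad (lam a) q) +
      ((G.N q + lam a q • Gt.N q) ⬝ᵥ grad (lam a) q) • (1 : Matrix (Fin n) (Fin n) ℝ) +
      vecMulVec (Gt.mat q *ᵥ grad (lam a) q) (grad (lam a) q) +
      (G.mat q + lam a q • Gt.mat q) * hess (lam a) q) *ᵥ v = 0 := by
    intro v
    have hg := hasDerivAt_grad h.isOpen (h.family.smooth a) hq v
    have hl := hasDerivAt_line (h.family.differentiableAt h.isOpen hq a) v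
    have h1 := (hasDerivAt_mat_mulVec (q := q) (v := v) G hg).add
      (hl.smul (hasDerivAt_mat_mulVec (q := q) (v := v) Gt hg))
    have h2 := h1.unique ((hasDerivAt_const (0 : ℝ) (0 : Fin n → ℝ)).congr_of_eventuallyEq
      ((eventually_line h.isOpen hq v).mono fun t ht => by
        have := (h.frame _ ht).pencil_mulVec a
        rw [add_mulVec, smul_mulVec] at this
        exact this))
    rw [← grad_dotProduct] at h2
    simp only [zero_smul, add_zero] at h2
    rw [← h2]
    simp only [add_mulVec, vecMulVec_mulVec, smul_mulVec, one_mulVec, ← mulVec_mulVec,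
      add_dotProduct, smul_dotProduct, op_smul_eq_smul, smul_add, add_smul, smul_smul, smul_eq_mul]
    rw [mul_comm (grad (lam a) q ⬝ᵥ v) (lam a q)]
    abel
  ext r s
  have := congrFun (key (Pi.single s 1)) r
  rwa [mulVec_single_one] at this

/-- Multiply the differentiated eigenvalue equation by `G̃` on the right and subtract the transpose.
The scalar and rank-one `G̃∇λ_a` terms are symmetric and drop out, and `λ_a G̃∇λ_a = -G∇λ_a` removes
the explicit root. What remains is linear in `λ_a`'s derivatives and can be summed with arbitrary
weights. -/
theorem antisymm_deriv_pencil (h : IsRootChart G Gt lam V e) {q : Fin n → ℝ} (hq : q ∈ V)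
    (a : Fin n) :
    vecMulVec (G.N q) (Gt.mat q *ᵥ grad (lam a) q) - vecMulVec (Gt.mat q *ᵥ grad (lam a) q) (G.N q)
      - vecMulVec (Gt.N q) (G.mat q *ᵥ grad (lam a) q)
      + vecMulVec (G.mat q *ᵥ grad (lam a) q) (Gt.N q)
      + G.mat q * hess (lam a) q * Gt.mat q - Gt.mat q * hess (lam a) q * G.mat q = 0 := by
  have h1 := congrArg (· * Gt.mat q) (h.deriv_pencil_mulVec hq a)
  have hv : grad (lam a) q ᵥ* Gt.mat q = Gt.mat q *ᵥ grad (lam a) q := by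
    rw [← mulVec_transpose, transpose_mat]
  have hS : G.mat q *ᵥ grad (lam a) q = -(lam a q • (Gt.mat q *ᵥ grad (lam a) q)) :=
    (h.frame q hq).mulVec_eq a
  simp only [Matrix.add_mul, vecMulVec_mul, hv, Matrix.zero_mul, Matrix.smul_mul,
    Matrix.one_mul] at h1
  have h2 := congrArg transpose h1
  simp only [transpose_add, transpose_smul, transpose_mul, transpose_vecMulVec, transpose_mat,
    transpose_hess h.isOpen (h.family.smooth a) hq, transpose_zero] at h2
  have h3 := congrArg₂ (· - ·) h1 h2
  simp only [sub_zero] at h3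
  rw [← h3, hS]
  simp only [add_vecMulVec, vecMulVec_add, smul_vecMulVec, vecMulVec_smul, vecMulVec_neg,
    neg_vecMulVec, Matrix.mul_assoc]
  abel

/-- Compatibility of the two brackets of the momenta. -/
theorem antisymm_rootHess (h : IsRootChart G Gt lam V e) {q : Fin n → ℝ} (hq : q ∈ V)
    (m : Fin n → ℝ) :
    vecMulVec (G.N q) (Gt.mat q *ᵥ rootCovector lam q m)
      - vecMulVec (Gt.mat q *ᵥ rootCovector lam q m) (G.N q)
      - vecMulVec (Gt.N q) (G.mat q *ᵥ rootCovector lam q m)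
      + vecMulVec (G.mat q *ᵥ rootCovector lam q m) (Gt.N q)
      + G.mat q * rootHess lam q m * Gt.mat q - Gt.mat q * rootHess lam q m * G.mat q = 0 := by
  rw [rootCovector_eq_sum, rootHess]
  induction (Finset.univ : Finset (Fin n)) using Finset.induction_on with
  | empty => simp
  | insert a s ha ih =>
    have h1 := congrArg (m a • ·) (h.antisymm_deriv_pencil hq a)
    simp only [smul_zero] at h1
    have h2 := congrArg₂ (· + ·) h1 ih
    simp only [add_zero] at h2
    rw [← h2]
    simp only [Finset.sum_insert ha, mulVec_add, mulVec_smul, vecMulVec_add, add_vecMulVec,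
      vecMulVec_smul, smul_vecMulVec, Matrix.mul_add, Matrix.add_mul, Matrix.mul_smul,
      Matrix.smul_mul, smul_add, smul_sub]
    abel

end IsRootChart
end BiCofactor

/-! ### The Jacobian matrix of `(λ, μ, c')`, the form of `Π₀`, and the differential of `h_{n-1}`. -/

namespace BiCofactor
open CofactorData
variable {n : ℕ} {V : Set (Fin n → ℝ)} {G Gt : CofactorData n} {M : (Fin n → ℝ) → Fin n → ℝ}
  {k kt : (Fin n → ℝ) → ℝ} {κ : Fin n → (Fin n → ℝ) → ℝ}
  {lam : Fin n → (Fin n → ℝ) → ℝ} {e : OpenPartialHomeomorph (Fin n → ℝ) (Fin n → ℝ)}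

/-- The matrix `Ñ wᵀ + (Ñ·w) I + G̃ H`, where `w = ∑ m_a dλ_a` and `H = ∑ m_a d²λ_a`. -/
noncomputable def connMatrix (Gt : CofactorData n) (lam : Fin n → (Fin n → ℝ) → ℝ)
    (q m : Fin n → ℝ) : Matrix (Fin n) (Fin n) ℝ :=
  vecMulVec (Gt.N q) (rootCovector lam q m) +
    (Gt.N q ⬝ᵥ rootCovector lam q m) • (1 : Matrix (Fin n) (Fin n) ℝ) +
    Gt.mat q * rootHess lam q m

theorem connMatrix_mulVec (q m v : Fin n → ℝ) : connMatrix Gt lam q m *ᵥ v =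
    (rootCovector lam q m ⬝ᵥ v) • Gt.N q + (Gt.N q ⬝ᵥ rootCovector lam q m) • v +
      Gt.mat q *ᵥ (rootHess lam q m *ᵥ v) := by
  simp only [connMatrix, add_mulVec, vecMulVec_mulVec, smul_mulVec, one_mulVec, op_smul_eq_smul,
    mulVec_mulVec]

/-- The Hamiltonian `h_{n-1}` in the coordinates `(q, μ, c')`. -/
noncomputable def rootHamiltonian (Gt : CofactorData n)
    (lam : Fin n → (Fin n → ℝ) → ℝ) (κ : (Fin n → ℝ) → ℝ) (x : Phase n) : ℝ :=
  (Gt.mat x.1).det *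
      (rootCovector lam x.1 x.2.1 ⬝ᵥ (Gt.mat x.1 *ᵥ rootCovector lam x.1 x.2.1))
    + κ x.1 - x.2.2 * ∑ j, lam j x.1

theorem eventually_line_phase {W : Set (Phase n)} (hW : IsOpen W) {x : Phase n} (hx : x ∈ W)
    (v : Phase n) : ∀ᶠ t : ℝ in nhds 0, x + t • v ∈ W := by
  have : ContinuousAt (fun t : ℝ => x + t • v) 0 := by fun_prop
  exact this (hW.mem_nhds (by simpa using hx))

theorem contDiff_coord (a : Idx n) : ContDiff ℝ ∞ (coord a : Phase n → ℝ) := by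
  rcases a with (i | i) | i
  · exact (contDiff_apply ℝ ℝ i).comp contDiff_fst
  · exact (contDiff_apply ℝ ℝ i).comp (contDiff_fst.comp contDiff_snd)
  · exact contDiff_snd.comp contDiff_snd

namespace IsRootChart

theorem differentiableAt_coord_dnMap (h : IsRootChart G Gt lam V e) {x : Phase n} (hx : x.1 ∈ V)
    (a : Idx n) : DifferentiableAt ℝ (fun y => coord a (dnMap G Gt lam y)) x := by
  have h1 := (h.contDiffOn_dnMap.contDiffAt ((h.isOpen.prod isOpen_univ).mem_nhds
    ⟨hx, trivial⟩)).differentiableAt (by simp)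
  exact ((contDiff_coord a).differentiable (by simp) _).comp x h1

theorem fderiv_coord_lam (h : IsRootChart G Gt lam V e) {x : Phase n} (hx : x.1 ∈ V)
    (i : Fin n) (v : Phase n) :
    fderiv ℝ (fun y => coord (.inl (.inl i)) (dnMap G Gt lam y)) x v = grad (lam i) x.1 ⬝ᵥ v.1 := by
  rw [grad_dotProduct]
  exact (hasDerivAt_line (h.differentiableAt_coord_dnMap hx _) v).unique
    (hasDerivAt_line (h.family.differentiableAt h.isOpen hx i) v.1)

theorem fderiv_coord_c (h : IsRootChart G Gt lam V e) {x : Phase n} (hx : x.1 ∈ V) (v : Phase n) :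
    fderiv ℝ (fun y => coord (.inr ()) (dnMap G Gt lam y)) x v =
      (-(4 * x.2.2) • ((Gt.mat x.1).adjugate *ᵥ Gt.N x.1)) ⬝ᵥ v.1
        + -2 * (Gt.mat x.1).det * v.2.2 := by
  have h2 : HasDerivAt (fun t : ℝ => -2 * (x.2.2 + t * v.2.2) * (Gt.mat (x.1 + t • v.1)).det) _ 0 :=
    ((((hasDerivAt_id (0 : ℝ)).mul_const v.2.2).const_add x.2.2).const_mul (-2)).mul
      (Gt.hasDerivAt_det_mat x.1 v.1)
  refine ((hasDerivAt_line (h.differentiableAt_coord_dnMap hx (.inr ())) v).unique h2).trans ?_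
  simp only [id, zero_mul, add_zero, zero_smul, smul_dotProduct, smul_eq_mul]
  ring

/-- Implicit differentiation of `G̃ w = -p`; the terms in `dq` assemble into `connMatrix`. -/
theorem mulVec_fderiv_coord_mu (h : IsRootChart G Gt lam V e) {x : Phase n} (hx : x.1 ∈ V)
    (v : Phase n) :
    Gt.mat x.1 *ᵥ rootCovector lam x.1
      (fun i => fderiv ℝ (fun y => coord (.inl (.inr i)) (dnMap G Gt lam y)) x v) =
      -(v.2.1 + connMatrix Gt lam x.1 (dnMap G Gt lam x).2.1 *ᵥ v.1) := by
  have hm : HasDerivAt (fun t : ℝ => (dnMap G Gt lam (x + t • v)).2.1)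
      (fun i => fderiv ℝ (fun y => coord (.inl (.inr i)) (dnMap G Gt lam y)) x v) 0 :=
    hasDerivAt_pi.2 fun i => hasDerivAt_line (h.differentiableAt_coord_dnMap hx (.inl (.inr i))) v
  have h1 := hasDerivAt_mat_mulVec Gt (q := x.1) (v := v.1)
    (hasDerivAt_rootCovector (v := v.1) h.isOpen h.family.smooth hx hm)
  have h2 : HasDerivAt (fun t : ℝ => -(x.2.1 + t • v.2.1)) (-v.2.1) 0 :=
    (((hasDerivAt_id (0 : ℝ)).smul_const v.2.1).const_add x.2.1).fun_neg.congr_deriv (by simp)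
  have h3 := h1.unique (h2.congr_of_eventuallyEq
    ((eventually_line_phase (h.isOpen.prod isOpen_univ) (x := x) ⟨hx, trivial⟩ v).mono
      fun t ht => h.mulVec_rootCovector_mu ht.1 _))
  simp only [zero_smul, add_zero, mulVec_add] at h3
  rw [neg_add, ← h3, connMatrix_mulVec]
  abel

theorem fderiv_coord_mu (h : IsRootChart G Gt lam V e) {x : Phase n} (hx : x.1 ∈ V)
    {C : Matrix (Fin n) (Fin n) ℝ} (hC : C * (Gt.mat x.1 * (rootJac lam x.1)ᵀ) = -1)
    (i : Fin n) (v : Phase n) :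
    fderiv ℝ (fun y => coord (.inl (.inr i)) (dnMap G Gt lam y)) x v =
      ((C * connMatrix Gt lam x.1 (dnMap G Gt lam x).2.1) *ᵥ v.1 + C *ᵥ v.2.1) i := by
  have h1 := congrArg (C *ᵥ ·) (h.mulVec_fderiv_coord_mu hx v)
  simp only [rootCovector, mulVec_mulVec] at h1
  rw [hC, neg_mulVec, one_mulVec, mulVec_neg, neg_inj] at h1
  rw [congrFun h1 i, mulVec_add, mulVec_mulVec, add_comm]

theorem jacobian_dnMap (h : IsRootChart G Gt lam V e) {x : Phase n} (hx : x.1 ∈ V)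
    {C : Matrix (Fin n) (Fin n) ℝ} (hC : C * (Gt.mat x.1 * (rootJac lam x.1)ᵀ) = -1) :
    jacobian (dnMap G Gt lam) x =
      fromBlocks (fromBlocks (rootJac lam x.1) 0
          (C * connMatrix Gt lam x.1 (dnMap G Gt lam x).2.1) C) 0
        (replicateRow Unit
          (Sum.elim (-(4 * x.2.2) • ((Gt.mat x.1).adjugate *ᵥ Gt.N x.1)) 0))
        ((-2 * (Gt.mat x.1).det) • (1 : Matrix Unit Unit ℝ)) := by
  ext a b
  rcases a with (i | i) | ⟨⟩
  · refine (h.fderiv_coord_lam hx i (basisVec b)).trans ?_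
    rcases b with (j | j) | ⟨⟩ <;> simp [basisVec, rootJac]
  · refine (h.fderiv_coord_mu hx hC i (basisVec b)).trans ?_
    rcases b with (j | j) | ⟨⟩ <;> simp [basisVec]
  · refine (h.fderiv_coord_c hx (basisVec b)).trans ?_
    rcases b with (j | j) | ⟨⟩ <;> simp [basisVec]

theorem exists_inverse (h : IsRootChart G Gt lam V e) {q : Fin n → ℝ} (hq : q ∈ V) :
    ∃ C : Matrix (Fin n) (Fin n) ℝ, C * (Gt.mat q * (rootJac lam q)ᵀ) = -1 ∧
      rootJac lam q * Gt.mat q * Cᵀ = -1 := by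
  have hf := h.frame q hq
  have hu : IsUnit (Gt.mat q * (rootJac lam q)ᵀ).det := by
    rw [det_mul, det_transpose]
    exact isUnit_iff_ne_zero.2 (mul_ne_zero hf.det_T hf.det_A)
  have h1 : -(Gt.mat q * (rootJac lam q)ᵀ)⁻¹ * (Gt.mat q * (rootJac lam q)ᵀ) = -1 := by
    rw [Matrix.neg_mul, nonsing_inv_mul _ hu]
  obtain ⟨C, hC⟩ : ∃ C, C * (Gt.mat q * (rootJac lam q)ᵀ) = -1 := ⟨_, h1⟩
  refine ⟨C, hC, ?_⟩
  have h2 := congrArg transpose hC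
  rwa [transpose_mul, transpose_mul, transpose_transpose, transpose_mat, transpose_neg,
    transpose_one] at h2

theorem transformed_Pi0 (h : IsRootChart G Gt lam V e) {x : Phase n} (hx : x.1 ∈ V) :
    transformed (dnMap G Gt lam) (Pi0 Gt) x = bordered (fromBlocks 0 1 (-1) 0) 0 := by
  obtain ⟨C, hC, hC'⟩ := h.exists_inverse hx
  have hT := (h.frame _ hx).det_T
  set m := (dnMap G Gt lam x).2.1 with hm
  have hp : Gt.mat x.1 *ᵥ rootCovector lam x.1 m = -x.2.1 := h.mulVec_rootCovector_mu hx x.2.1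
  have hF : (-Gt.F x.1 x.2.1)ᵀ = -(-Gt.F x.1 x.2.1) := by
    simp [CofactorData.F, transpose_vecMulVec]
  have hR : (-Gt.mat x.1)ᵀ = -Gt.mat x.1 := by rw [transpose_neg, transpose_mat]
  have hw : rootCovector lam x.1 m ᵥ* Gt.mat x.1 = -x.2.1 := by
    rw [← mulVec_transpose, transpose_mat, hp]
  have := transform_blocks (A := rootJac lam x.1) (C := C)
    (K := connMatrix Gt lam x.1 m) hR hF (-(4 * x.2.2) • ((Gt.mat x.1).adjugate *ᵥ Gt.N x.1)) 0
    (-(2 * x.2.2) • Gt.N x.1) (-2 * (Gt.mat x.1).det)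
  rw [neg_neg] at this
  rw [transformed, h.jacobian_dnMap hx hC, Pi0, this]
  have e1 : rootJac lam x.1 * -Gt.mat x.1 * Cᵀ = 1 := by
    rw [Matrix.mul_neg, Matrix.neg_mul, hC', neg_neg]
  -- The Hessian and scalar terms are symmetric and cancel; the rank-one terms give `F̃` through `G̃
  -- w = -p`.
  have e2 : connMatrix Gt lam x.1 m * -Gt.mat x.1 - -Gt.mat x.1 * (connMatrix Gt lam x.1 m)ᵀ
      + -Gt.F x.1 x.2.1 = 0 := by
    simp only [connMatrix, transpose_add, transpose_smul, transpose_mul, transpose_one,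
      transpose_vecMulVec, transpose_mat, h.transpose_rootHess hx, Matrix.mul_neg, Matrix.neg_mul,
      Matrix.add_mul, Matrix.mul_add, vecMulVec_mul, mul_vecMulVec, Matrix.smul_mul,
      Matrix.mul_smul, Matrix.one_mul, Matrix.mul_one, hw, hp, CofactorData.F, vecMulVec_neg,
      neg_vecMulVec, neg_mulVec, smul_neg, Matrix.mul_assoc]
    abel
  -- The constants `4c` and `2 · 2c` match because `c' = -2c det G̃`: this makes `c'` a Casimir of
  -- `Π₀`.
  have e3 : -(-Gt.mat x.1 *ᵥ (-(4 * x.2.2) • ((Gt.mat x.1).adjugate *ᵥ Gt.N x.1))) +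
      (-2 * (Gt.mat x.1).det) • (connMatrix Gt lam x.1 m *ᵥ 0 + -(2 * x.2.2) • Gt.N x.1) = 0 := by
    rw [neg_mulVec, neg_neg, mulVec_smul, mulVec_mulVec, mul_adjugate, smul_mulVec, one_mulVec,
      mulVec_zero, zero_add, smul_smul, smul_smul, ← add_smul]
    rw [show -(4 * x.2.2) * (Gt.mat x.1).det + -2 * (Gt.mat x.1).det * -(2 * x.2.2) = 0 by ring,
      zero_smul]
  rw [e1, e2, e3, mulVec_zero, mulVec_zero, smul_zero, transpose_one, Matrix.mul_zero,
    Matrix.zero_mul]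
  congr 1
  ext i; rcases i with i | i <;> rfl

theorem contDiffOn_rootHamiltonian (h : IsRootChart G Gt lam V e) {κ : (Fin n → ℝ) → ℝ}
    (hκ : ContDiffOn ℝ ∞ κ V) : ContDiffOn ℝ ∞ (rootHamiltonian Gt lam κ) (V ×ˢ Set.univ) := by
  have hfst : ContDiffOn ℝ ∞ (fun x : Phase n => x.1) (V ×ˢ Set.univ) := contDiff_fst.contDiffOn
  have hm : Set.MapsTo (fun x : Phase n => x.1) (V ×ˢ Set.univ) V := fun x hx => hx.1
  have hw : ∀ j, ContDiffOn ℝ ∞ (fun x : Phase n => rootCovector lam x.1 x.2.1 j)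
      (V ×ˢ Set.univ) := fun j => by
    simp only [rootCovector_apply]
    exact ContDiffOn.sum fun a _ => ContDiffOn.mul (by fun_prop)
      ((contDiffOn_grad h.isOpen (h.family.smooth a) j).comp hfst hm)
  refine (((Gt.contDiff_det.comp contDiff_fst).contDiffOn.mul ?_).add (hκ.comp hfst hm)).sub
    (ContDiffOn.mul (by fun_prop)
      (ContDiffOn.sum fun j _ => (h.family.smooth j).comp hfst hm))
  simp only [dotProduct, mulVec]
  exact ContDiffOn.sum fun j _ => (hw j).mul (ContDiffOn.sum fun i _ =>
    ((Gt.contDiff_mat_apply j i).comp contDiff_fst).contDiffOn.mul (hw i))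

theorem fderiv_rootHamiltonian (h : IsRootChart G Gt lam V e) {κ : (Fin n → ℝ) → ℝ}
    (hκ : ContDiffOn ℝ ∞ κ V) {x : Phase n} (hx : x.1 ∈ V) (v u : Fin n → ℝ) :
    fderiv ℝ (rootHamiltonian Gt lam κ) x (v, u, 0) =
      2 * (((Gt.mat x.1).adjugate *ᵥ Gt.N x.1) ⬝ᵥ v) *
          (rootCovector lam x.1 x.2.1 ⬝ᵥ (Gt.mat x.1 *ᵥ rootCovector lam x.1 x.2.1)) +
        (Gt.mat x.1).det * (2 * ((rootHess lam x.1 x.2.1 *ᵥ v + rootCovector lam x.1 u) ⬝ᵥ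
            (Gt.mat x.1 *ᵥ rootCovector lam x.1 x.2.1)) +
          2 * ((Gt.N x.1 ⬝ᵥ rootCovector lam x.1 x.2.1) * (rootCovector lam x.1 x.2.1 ⬝ᵥ v))) +
        grad κ x.1 ⬝ᵥ v - x.2.2 * ∑ j, grad (lam j) x.1 ⬝ᵥ v := by
  have hd : DifferentiableAt ℝ (rootHamiltonian Gt lam κ) x :=
    ((h.contDiffOn_rootHamiltonian hκ).contDiffAt ((h.isOpen.prod isOpen_univ).mem_nhds
      ⟨hx, trivial⟩)).differentiableAt (by simp)
  have hκd : DifferentiableAt ℝ κ x.1 :=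
    (hκ.contDiffAt (h.isOpen.mem_nhds hx)).differentiableAt (by simp)
  have hm : HasDerivAt (fun t : ℝ => x.2.1 + t • u) u 0 := by
    simpa using ((hasDerivAt_id (0 : ℝ)).smul_const u).const_add x.2.1
  have hw := hasDerivAt_rootCovector (v := v) h.isOpen h.family.smooth hx hm
  have h1 := (((Gt.hasDerivAt_det_mat x.1 v).mul
    (hasDerivAt_dotProduct hw (hasDerivAt_mat_mulVec (q := x.1) (v := v) Gt hw))).add
    (hasDerivAt_line hκd v)).sub ((HasDerivAt.fun_sum (u := Finset.univ) fun j _ =>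
      hasDerivAt_line (h.family.differentiableAt h.isOpen hx j) v).const_mul x.2.2)
  have h2 := (hasDerivAt_line hd (v, u, 0)).congr_of_eventuallyEq
    (f₁ := fun t : ℝ => (Gt.mat (x.1 + t • v)).det *
      (rootCovector lam (x.1 + t • v) (x.2.1 + t • u) ⬝ᵥ
        (Gt.mat (x.1 + t • v) *ᵥ rootCovector lam (x.1 + t • v) (x.2.1 + t • u)))
    + κ (x.1 + t • v) - x.2.2 * ∑ j, lam j (x.1 + t • v))
    (Filter.Eventually.of_forall fun t => by simp [rootHamiltonian])
  refine (h2.unique h1).trans ?_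
  have hs : ∀ y z : Fin n → ℝ, y ⬝ᵥ (Gt.mat x.1 *ᵥ z) = z ⬝ᵥ (Gt.mat x.1 *ᵥ y) := fun y z => by
    rw [dotProduct_mulVec, ← mulVec_transpose, transpose_mat, dotProduct_comm]
  simp only [zero_smul, add_zero, grad_dotProduct, dotProduct_add, dotProduct_smul, smul_eq_mul]
  rw [hs (rootCovector lam x.1 x.2.1) (rootHess lam x.1 x.2.1 *ᵥ v + rootCovector lam x.1 u),
    dotProduct_comm (rootCovector lam x.1 x.2.1) (Gt.N x.1)]
  simp only [add_dotProduct]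
  ring

end IsRootChart
end BiCofactor

/-! ### The Hamiltonians in root coordinates and the form of `Π₁`. -/

namespace BiCofactor
open CofactorData
variable {n : ℕ} {V : Set (Fin n → ℝ)} {G Gt : CofactorData n} {M : (Fin n → ℝ) → Fin n → ℝ}
  {k kt : (Fin n → ℝ) → ℝ} {κ : Fin n → (Fin n → ℝ) → ℝ}
  {lam : Fin n → (Fin n → ℝ) → ℝ} {e : OpenPartialHomeomorph (Fin n → ℝ) (Fin n → ℝ)}

namespace IsRootChart

theorem detCoeff_eq (h : IsRootChart G Gt lam V e) {q : Fin n → ℝ} (hq : q ∈ V) (i : ℕ) :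
    detCoeff G Gt i q = (Gt.mat q).det * viete i (fun a => lam a q) := by
  have h1 := congrArg (fun P : ℝ[X] => P.coeff i) (h.frame q hq).det_pencil
  simp only [coeff_C_mul] at h1
  exact h1

theorem exists_rootCovector (h : IsRootChart G Gt lam V e) {q : Fin n → ℝ} (hq : q ∈ V)
    (v : Fin n → ℝ) : ∃ m, v = Gt.mat q *ᵥ rootCovector lam q m :=
  ⟨_, by rw [h.mulVec_rootCovector_mu hq (-v), neg_neg]⟩

/-- The `A_i` act diagonally in the frame of root differentials, with eigenvalues the coefficients
of `∏_{j≠a}(ξ - λ_j)`. -/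
theorem cofCoeff_mulVec (h : IsRootChart G Gt lam V e) {q : Fin n → ℝ} (hq : q ∈ V) (i : ℕ)
    (m : Fin n → ℝ) :
    cofCoeff G Gt i q *ᵥ (Gt.mat q *ᵥ rootCovector lam q m) =
      (Gt.mat q).det • rootCovector lam q
        (fun a => prodCoeff (Finset.univ.erase a) i (fun b => lam b q) * m a) := by
  rw [rootCovector_eq_sum, rootCovector_eq_sum, mulVec_sum, mulVec_sum, Finset.smul_sum]
  refine Finset.sum_congr rfl fun a _ => ?_
  rw [mulVec_smul, mulVec_smul, smul_smul]
  refine (congrArg (m a • ·) ((h.frame q hq).adjugate_coeff_mulVec i a)).trans ?_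
  change m a • _ • grad (lam a) q = _
  rw [smul_smul]; congr 1; ring

theorem rootCovector_dotProduct (h : IsRootChart G Gt lam V e) {q : Fin n → ℝ} (hq : q ∈ V)
    (m m' : Fin n → ℝ) :
    rootCovector lam q m ⬝ᵥ (Gt.mat q *ᵥ rootCovector lam q m') =
      ∑ a, m a * ((grad (lam a) q ⬝ᵥ (Gt.mat q *ᵥ grad (lam a) q)) * m' a) := by
  rw [rootCovector_eq_sum q m, sum_dotProduct]
  refine Finset.sum_congr rfl fun a _ => ?_
  rw [smul_dotProduct, smul_eq_mul]
  congr 1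
  exact (h.frame q hq).mulVec_mulVec_transpose m' a

theorem hamiltonian_phaseOfRoot (h : IsRootChart G Gt lam V e) (κ : Fin n → (Fin n → ℝ) → ℝ)
    {x : Phase n} (hx : x.1 ∈ V) (i : ℕ) :
    hamiltonian G Gt κ i (phaseOfRoot Gt lam x) =
      (if hi : i < n then (Gt.mat x.1).det * ∑ a,
        prodCoeff (Finset.univ.erase a) i (fun b => lam b x.1) *
          ((grad (lam a) x.1 ⬝ᵥ (Gt.mat x.1 *ᵥ grad (lam a) x.1)) * x.2.1 a ^ 2) + κ ⟨i, hi⟩ x.1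
        else 0) + x.2.2 * viete i (fun a => lam a x.1) := by
  obtain ⟨q, m, c⟩ := x
  have hT := (h.frame q hx).det_T
  simp only [hamiltonian, phaseOfRoot]
  rw [sub_eq_add_neg]
  congr 1
  · split_ifs with hi
    · congr 1
      rw [mulVec_neg, neg_dotProduct, dotProduct_neg, neg_neg, h.cofCoeff_mulVec hx,
        dotProduct_smul, dotProduct_comm, h.rootCovector_dotProduct hx, smul_eq_mul]
      congr 1
      exact Finset.sum_congr rfl fun a _ => by ring
    · rfl
  · rw [h.detCoeff_eq hx]
    field_simp

theorem hamiltonian_last (h : IsRootChart G Gt lam V e) (hn : 1 ≤ n)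
    (κ : Fin n → (Fin n → ℝ) → ℝ) {x : Phase n} (hx : x.1 ∈ V) :
    hamiltonian G Gt κ (n - 1) (phaseOfRoot Gt lam x) =
      rootHamiltonian Gt lam (κ ⟨n - 1, by omega⟩) x := by
  rw [h.hamiltonian_phaseOfRoot κ hx, dif_pos (by omega), rootHamiltonian,
    h.rootCovector_dotProduct hx, viete_pred hn, mul_neg, ← sub_eq_add_neg]
  congr 4
  ext a
  rw [prodCoeff_erase_last]; ring

theorem differentiableAt_rootHamiltonian_symm (h : IsRootChart G Gt lam V e)
    {κ : (Fin n → ℝ) → ℝ} (hκ : ContDiffOn ℝ ∞ κ V) {z : Phase n} (hz : z.1 ∈ e.target) :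
    DifferentiableAt ℝ (fun z : Phase n => rootHamiltonian Gt lam κ (e.symm z.1, z.2)) z :=
  (((h.contDiffOn_rootHamiltonian hκ).comp h.contDiffOn_symm_fst fun _ hx =>
    ⟨h.symm_mem hx.1, trivial⟩).contDiffAt ((e.open_target.prod isOpen_univ).mem_nhds
      ⟨hz, trivial⟩)).differentiableAt (by simp)

theorem fderiv_mu_rootHamiltonian (h : IsRootChart G Gt lam V e)
    {κ : (Fin n → ℝ) → ℝ} (hκ : ContDiffOn ℝ ∞ κ V) {z : Phase n} (hz : z.1 ∈ e.target)
    (u : Fin n → ℝ) :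
    fderiv ℝ (fun z : Phase n => rootHamiltonian Gt lam κ (e.symm z.1, z.2)) z (0, u, 0) =
      fderiv ℝ (rootHamiltonian Gt lam κ) (e.symm z.1, z.2) (0, u, 0) := by
  have hd : DifferentiableAt ℝ (rootHamiltonian Gt lam κ) (e.symm z.1, z.2) :=
    ((h.contDiffOn_rootHamiltonian hκ).contDiffAt ((h.isOpen.prod isOpen_univ).mem_nhds
      ⟨h.symm_mem hz, trivial⟩)).differentiableAt (by simp)
  refine (hasDerivAt_line (h.differentiableAt_rootHamiltonian_symm hκ hz) (0, u, 0)).unique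
    ((hasDerivAt_line hd (0, u, 0)).congr_of_eventuallyEq
      (Filter.Eventually.of_forall fun t => ?_))
  simp

/-- Chain rule along the curve `t ↦ λ(q + tv)`, on which the inverse chart returns `q + tv`; the
derivative of the inverse chart never has to be computed. -/
theorem fderiv_lam_rootHamiltonian (h : IsRootChart G Gt lam V e)
    {κ : (Fin n → ℝ) → ℝ} (hκ : ContDiffOn ℝ ∞ κ V) {z : Phase n} (hz : z.1 ∈ e.target)
    (v : Fin n → ℝ) :
    rootCovector lam (e.symm z.1) (fun i => fderiv ℝ
      (fun z : Phase n => rootHamiltonian Gt lam κ (e.symm z.1, z.2)) z (Pi.single i 1, 0, 0)) ⬝ᵥ v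
      = fderiv ℝ (rootHamiltonian Gt lam κ) (e.symm z.1, z.2) (v, 0, 0) := by
  have hq := h.symm_mem hz
  have hd : DifferentiableAt ℝ (rootHamiltonian Gt lam κ) (e.symm z.1, z.2) :=
    ((h.contDiffOn_rootHamiltonian hκ).contDiffAt ((h.isOpen.prod isOpen_univ).mem_nhds
      ⟨hq, trivial⟩)).differentiableAt (by simp)
  have hE : HasDerivAt (fun t : ℝ => (((fun i => lam i (e.symm z.1 + t • v)), z.2) : Phase n))
      ((fun i => grad (lam i) (e.symm z.1) ⬝ᵥ v), 0) 0 :=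
    (hasDerivAt_pi.2 fun i => by
      rw [grad_dotProduct]
      exact hasDerivAt_line (h.family.differentiableAt h.isOpen hq i) v).prodMk
        (hasDerivAt_const _ _)
  have hE0 : (((fun i => lam i (e.symm z.1 + (0 : ℝ) • v)), z.2) : Phase n) = z := by
    rw [zero_smul, add_zero, h.lam_symm hz]
  have h1 := HasFDerivAt.comp_hasDerivAt_of_eq (0 : ℝ)
    (h.differentiableAt_rootHamiltonian_symm hκ hz).hasFDerivAt hE hE0.symm
  have h2 := (hasDerivAt_line hd (v, 0, 0)).congr_of_eventuallyEq
    (f₁ := (fun z : Phase n => rootHamiltonian Gt lam κ (e.symm z.1, z.2)) ∘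
      fun t : ℝ => (((fun i => lam i (e.symm z.1 + t • v)), z.2) : Phase n))
    ((eventually_line h.isOpen hq v).mono fun t ht => by
      have : z.2 + ((0 : Fin n → ℝ), (0 : ℝ)) = z.2 := add_zero _
      simp [h.symm_lam ht, this])
  rw [← h1.unique h2, rootCovector_eq_sum, sum_dotProduct]
  rw [show (((fun i => grad (lam i) (e.symm z.1) ⬝ᵥ v), 0) : Phase n) =
    ∑ i, (grad (lam i) (e.symm z.1) ⬝ᵥ v) • ((Pi.single i 1, 0, 0) : Phase n) from ?_, map_sum]
  · simp only [map_smul, smul_dotProduct, smul_eq_mul, mul_comm]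
  · refine Prod.ext ?_ ?_
    · rw [Prod.fst_sum]
      exact pi_eq_sum_univ' _
    · rw [Prod.snd_sum]
      exact (Finset.sum_eq_zero fun i _ => smul_zero _).symm

/-- The gradient of `h_{n-1}` with respect to `λ`, expressed in the coordinates `q`. -/
theorem rootCovector_fderiv_lam (h : IsRootChart G Gt lam V e)
    {κ : (Fin n → ℝ) → ℝ} (hκ : ContDiffOn ℝ ∞ κ V) {z : Phase n} (hz : z.1 ∈ e.target)
    {q w : Fin n → ℝ} (hqz : q = e.symm z.1) (hw : w = rootCovector lam q z.2.1) :
    rootCovector lam q (fun i => fderiv ℝ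
      (fun z : Phase n => rootHamiltonian Gt lam κ (e.symm z.1, z.2)) z (Pi.single i 1, 0, 0)) =
      (2 * (w ⬝ᵥ (Gt.mat q *ᵥ w))) • ((Gt.mat q).adjugate *ᵥ Gt.N q) +
        (2 * (Gt.mat q).det) • (rootHess lam q z.2.1 *ᵥ (Gt.mat q *ᵥ w) + (Gt.N q ⬝ᵥ w) • w) +
        grad κ q - z.2.2 • ∑ j, grad (lam j) q := by
  have hq : q ∈ V := hqz ▸ h.symm_mem hz
  refine dotProduct_eq _ _ fun v => ?_
  have hs : (rootHess lam q z.2.1 *ᵥ v) ⬝ᵥ (Gt.mat q *ᵥ w) =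
      (rootHess lam q z.2.1 *ᵥ (Gt.mat q *ᵥ w)) ⬝ᵥ v := by
    rw [dotProduct_comm, dotProduct_mulVec, ← mulVec_transpose, h.transpose_rootHess hq]
  have h0 : rootCovector lam q (0 : Fin n → ℝ) = 0 := mulVec_zero _
  subst hqz
  rw [h.fderiv_lam_rootHamiltonian hκ hz, h.fderiv_rootHamiltonian hκ (x := (e.symm z.1, z.2)) hq]
  simp only [← hw, add_dotProduct, sub_dotProduct, smul_dotProduct, smul_eq_mul, h0, add_zero, hs,
    sum_dotProduct]
  ring

/-- The top coefficients of `∏_{j≠a}(ξ - λ_j)` are all `1`, so `A_{n-1}` acts as `det G̃ · G̃⁻¹`. -/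
theorem mulVec_grad_last (h : IsRootChart G Gt lam V e) {q : Fin n → ℝ} (hq : q ∈ V)
    {κ : (Fin n → ℝ) → ℝ}
    (hκ : (2 : ℝ) • (cofCoeff G Gt (n - 1) q *ᵥ M q) + grad κ q = 0) :
    Gt.mat q *ᵥ grad κ q = -(2 * (Gt.mat q).det) • M q := by
  obtain ⟨m, hm⟩ := h.exists_rootCovector hq (M q)
  rw [eq_neg_of_add_eq_zero_right hκ, hm, h.cofCoeff_mulVec hq]
  simp only [prodCoeff_erase_last, one_mul]
  rw [mulVec_neg, mulVec_smul, mulVec_smul, smul_smul, neg_smul]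

theorem transformed_Pi1 (h : IsRootChart G Gt lam V e) {κ : (Fin n → ℝ) → ℝ}
    (hκs : ContDiffOn ℝ ∞ κ V)
    (hκ : ∀ q ∈ V, (2 : ℝ) • (cofCoeff G Gt (n - 1) q *ᵥ M q) + grad κ q = 0)
    {z : Phase n} (hz : z.1 ∈ e.target) :
    transformed (dnMap G Gt lam) (Pi1 G M) (phaseOfRoot Gt lam (e.symm z.1, z.2)) =
      bordered (fromBlocks 0 (diagonal z.1) (-diagonal z.1) 0)
        (Sum.elim
          (fun i => fderiv ℝ (fun z : Phase n => rootHamiltonian Gt lam κ (e.symm z.1, z.2)) z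
            (0, Pi.single i 1, 0))
          (fun i => -fderiv ℝ (fun z : Phase n => rootHamiltonian Gt lam κ (e.symm z.1, z.2)) z
            (Pi.single i 1, 0, 0))) := by
  obtain ⟨y, m, c'⟩ := z
  change y ∈ e.target at hz
  have hq := h.symm_mem hz
  have hgrad := fun q w => h.rootCovector_fderiv_lam hκs (z := (y, m, c')) hz (q := q) (w := w)
  have hmu := fun u => h.fderiv_mu_rootHamiltonian hκs (z := (y, m, c')) hz u
  have hy := h.lam_symm hz
  set q := e.symm y with hqdef
  set a : Fin n → ℝ := fun i => fderiv ℝ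
    (fun z : Phase n => rootHamiltonian Gt lam κ (e.symm z.1, z.2)) (y, m, c') (Pi.single i 1, 0, 0)
    with ha
  set x := phaseOfRoot Gt lam (q, m, c') with hxdef
  have hx1 : x.1 = q := rfl
  have hx : x.1 ∈ V := hq
  have hxm : (dnMap G Gt lam x).2 = (m, c') :=
    congrArg Prod.snd (h.dnMap_phaseOfRoot (x := (q, m, c')) hq)
  obtain ⟨C, hC, hC'⟩ := h.exists_inverse hx
  have hT := (h.frame _ hx).det_T
  have hF : (G.F q x.2.1)ᵀ = -(G.F q x.2.1) := by
    simp [CofactorData.F, transpose_vecMulVec]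
  set w := rootCovector lam q m with hw
  have hp : x.2.1 = -(Gt.mat q *ᵥ w) := rfl
  have hc' : c' = -2 * x.2.2 * (Gt.mat q).det := (congrArg Prod.snd hxm).symm
  rw [transformed, h.jacobian_dnMap hx hC, Pi1, hxm, hx1]
  rw [hx1] at hC hC' hT
  rw [transform_blocks (G.transpose_mat q) hF]
  have e1 : rootJac lam q * G.mat q * Cᵀ = diagonal y := by
    rw [(h.frame q hq).mul_eq, Matrix.neg_mul, Matrix.mul_assoc, hC', hy]
    simp
  have hwG : w ᵥ* G.mat q = G.mat q *ᵥ w := by rw [← mulVec_transpose, transpose_mat]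
  -- Here the momentum brackets vanish by `antisymm_rootHess`, since `F` is built from `p = -G̃ w`.
  have e2 : connMatrix Gt lam q m * G.mat q - G.mat q * (connMatrix Gt lam q m)ᵀ
      + G.F q x.2.1 = 0 := by
    have h1 := h.antisymm_rootHess hq m
    rw [← hw] at h1
    rw [← neg_eq_zero, ← h1, hp]
    simp only [connMatrix, transpose_add, transpose_smul, transpose_mul, transpose_one,
      transpose_vecMulVec, transpose_mat, h.transpose_rootHess hq,
      Matrix.add_mul, Matrix.mul_add, vecMulVec_mul, mul_vecMulVec, Matrix.smul_mul,
      Matrix.mul_smul, Matrix.one_mul, Matrix.mul_one, ← hw, hwG, CofactorData.F, vecMulVec_neg,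
      neg_vecMulVec, Matrix.mul_assoc]
    abel
  have e3 : (-2 * (Gt.mat q).det) • (rootJac lam q *ᵥ x.2.1) = fun i => fderiv ℝ
      (fun z : Phase n => rootHamiltonian Gt lam κ (e.symm z.1, z.2)) (y, m, c')
        (0, Pi.single i 1, 0) := by
    ext i
    have h1 : rootCovector lam q (Pi.single i 1) = grad (lam i) q := by
      rw [rootCovector, mulVec_single_one]; rfl
    rw [hmu, h.fderiv_rootHamiltonian hκs (x := (q, m, c')) hq]
    simp only [dotProduct_zero, mulVec_zero, zero_add, h1, ← hw, mul_zero, add_zero, zero_mul,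
      Finset.sum_const_zero, sub_zero, hp, mulVec_neg, Pi.smul_apply, Pi.neg_apply, smul_eq_mul]
    rw [show (rootJac lam q *ᵥ (Gt.mat q *ᵥ w)) i = grad (lam i) q ⬝ᵥ (Gt.mat q *ᵥ w) from rfl]
    ring
  -- The last column, multiplied through to avoid `C`. The force enters by `G̃∇κ = -2 det G̃ M`, and
  -- the `c'` term by `G̃ ∑∇λ_j = 2Ω` together with `G cof(G̃) Ñ = det G̃ (Ω + N)`.
  have e4 : -(G.mat q *ᵥ (-(4 * x.2.2) • ((Gt.mat q).adjugate *ᵥ Gt.N q))) +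
      (-2 * (Gt.mat q).det) • (connMatrix Gt lam q m *ᵥ x.2.1 + (M q + (2 * x.2.2) • G.N q)) =
      Gt.mat q *ᵥ rootCovector lam q a := by
    have hOm : Gt.mat q *ᵥ ∑ j, grad (lam j) q = (2 : ℝ) • Om G Gt q :=
      ((h.frame q hq).two_smul_eq).symm
    have hTadj : Gt.mat q *ᵥ ((Gt.mat q).adjugate *ᵥ Gt.N q) = (Gt.mat q).det • Gt.N q := by
      rw [mulVec_mulVec, mul_adjugate, smul_mulVec, one_mulVec]
    have hGadj : G.mat q *ᵥ ((Gt.mat q).adjugate *ᵥ Gt.N q) =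
        (Gt.mat q).det • (Om G Gt q + G.N q) := by
      have hadj : (Gt.mat q).adjugate = (Gt.mat q).det • (Gt.mat q)⁻¹ := by
        rw [inv_def, smul_smul, Ring.mul_inverse_cancel _ (isUnit_iff_ne_zero.2 hT), one_smul]
      rw [hadj, smul_mulVec, mulVec_smul, mulVec_mulVec, Om, sub_add_cancel]
    rw [hgrad q w rfl rfl]
    simp only [mulVec_sub, mulVec_add, mulVec_smul, hOm, hTadj, hGadj, hp, mulVec_neg,
      connMatrix_mulVec, ← hw, h.mulVec_grad_last hq (hκ q hq), hc']
    ext i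
    simp only [Pi.add_apply, Pi.sub_apply, Pi.neg_apply, Pi.smul_apply, smul_eq_mul]
    ring
  rw [e1, e2, e3, e4]
  have e5 : C *ᵥ (Gt.mat q *ᵥ rootCovector lam q a) = -a := by
    rw [rootCovector, mulVec_mulVec, mulVec_mulVec, Matrix.mul_assoc, hC, neg_mulVec, one_mulVec]
  rw [e5, Matrix.mul_zero, Matrix.zero_mul, diagonal_transpose]
  rfl

theorem hasDNForm (h : IsRootChart G Gt lam V e) (hn : 1 ≤ n)
    (hκ : IsQuasiPotentialFamily V G Gt M k kt κ) :
    HasDNForm h.phaseChart (Pi0 Gt) (Pi1 G M) (hamiltonian G Gt κ (n - 1)) := by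
  intro z hz
  have hz' : z.1 ∈ e.target := hz.1
  refine ⟨h.transformed_Pi0 (x := phaseOfRoot Gt lam (e.symm z.1, z.2)) (h.symm_mem hz'), ?_⟩
  have he : (hamiltonian G Gt κ (n - 1) ∘ h.phaseChart.symm) =ᶠ[nhds z]
      fun z : Phase n => rootHamiltonian Gt lam (κ ⟨n - 1, by omega⟩) (e.symm z.1, z.2) := by
    filter_upwards [h.phaseChart.open_target.mem_nhds hz] with y hy
    exact h.hamiltonian_last hn κ (x := (e.symm y.1, y.2)) (h.symm_mem hy.1)
  simp only [partialDeriv, he.fderiv_eq]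
  exact h.transformed_Pi1 (hκ.smooth _) (hκ.quasi ⟨n - 1, by omega⟩) hz'

end IsRootChart
end BiCofactor

/-! ### Separation of variables: the Stäckel form. -/

namespace BiCofactor
open CofactorData
variable {n : ℕ} {V : Set (Fin n → ℝ)} {G Gt : CofactorData n} {M : (Fin n → ℝ) → Fin n → ℝ}
  {k kt : (Fin n → ℝ) → ℝ} {κ : Fin n → (Fin n → ℝ) → ℝ}
  {lam : Fin n → (Fin n → ℝ) → ℝ} {e : OpenPartialHomeomorph (Fin n → ℝ) (Fin n → ℝ)}

/-- A function whose derivative only involves the `a`-th coordinate depends on it alone. -/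
theorem eq_of_fderiv_eq_zero {S : Set (Fin n → ℝ)} (hS : IsOpen S) (hc : Convex ℝ S)
    {f : (Fin n → ℝ) → ℝ} (hf : DifferentiableOn ℝ f S) {a : Fin n}
    (h0 : ∀ y ∈ S, ∀ u : Fin n → ℝ, u a = 0 → fderiv ℝ f y u = 0) {y y' : Fin n → ℝ}
    (hy : y ∈ S) (hy' : y' ∈ S) (ha : y a = y' a) : f y = f y' := by
  obtain ⟨z, hz, he⟩ := domain_mvt (f' := fderiv ℝ f)
    (fun x hx => (hf.differentiableAt (hS.mem_nhds hx)).hasFDerivAt.hasFDerivWithinAt)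
    hc hy hy'
  rw [h0 z (hc.segment_subset hy hy' hz) (y' - y) (by simp [ha])] at he
  linarith

theorem contDiffOn_genFun {κ : Fin n → (Fin n → ℝ) → ℝ} (hκ : ∀ i, ContDiffOn ℝ ∞ (κ i) V)
    {f : (Fin n → ℝ) → ℝ} (hf : ContDiffOn ℝ ∞ f V) :
    ContDiffOn ℝ ∞ (fun q => genFun κ (f q) q) V := by
  simp only [genFun]
  exact ContDiffOn.sum fun i _ => (hκ i).mul (hf.pow _)

namespace IsRootChart

/-- Equates the two expressions for the denominator of `μ_a`. Up to `1/Δ_a`, the kinetic coefficient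
of `μ_a²` is a function of `λ_a` alone. -/
theorem det_mul_Delta (h : IsRootChart G Gt lam V e) {q : Fin n → ℝ} (hq : q ∈ V) (a : Fin n) :
    (Gt.mat q).det * (grad (lam a) q ⬝ᵥ (Gt.mat q *ᵥ grad (lam a) q)) =
      -4 * (pencilData G Gt (lam a q)).borderedDet / Delta a (fun i => lam i q) := by
  have hf := h.frame q hq
  have h1 := hf.dotProduct_adjugate a
  rw [← muDen, h.family.muDen_eq hq hf.det_T] at h1
  change _ = _ * (grad (lam a) q ⬝ᵥ (Gt.mat q *ᵥ grad (lam a) q)) / 4 at h1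
  rw [eq_div_iff (Delta_ne_zero hf.inj a)]
  linarith

/-- The differential of `∑ κ_i λ_a^i` is proportional to `dλ_a`. -/
theorem exists_fderiv_genFun (h : IsRootChart G Gt lam V e)
    (hκ : IsQuasiPotentialFamily V G Gt M k kt κ) {q : Fin n → ℝ} (hq : q ∈ V) (a : Fin n) :
    ∃ s : ℝ, ∀ v, fderiv ℝ (fun q => genFun κ (lam a q) q) q v = s * fderiv ℝ (lam a) q v := by
  obtain ⟨m, hm⟩ := h.exists_rootCovector hq (M q)
  have hd : DifferentiableAt ℝ (fun q => genFun κ (lam a q) q) q :=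
    ((contDiffOn_genFun hκ.smooth (h.family.smooth a)).contDiffAt
      (h.isOpen.mem_nhds hq)).differentiableAt (by simp)
  have hκd : ∀ i, DifferentiableAt ℝ (κ i) q := fun i =>
    ((hκ.smooth i).contDiffAt (h.isOpen.mem_nhds hq)).differentiableAt (by simp)
  have hgrad : ∀ i : Fin n, ∀ v, fderiv ℝ (κ i) q v = ∑ b, (-2 * (Gt.mat q).det * m b *
      fderiv ℝ (lam b) q v) * prodCoeff (Finset.univ.erase b) i (fun j => lam j q) := by
    intro i v
    rw [← grad_dotProduct, eq_neg_of_add_eq_zero_right (hκ.quasi i q hq), hm,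
      h.cofCoeff_mulVec hq, rootCovector_eq_sum, neg_dotProduct, smul_dotProduct,
      smul_dotProduct, sum_dotProduct, smul_eq_mul, smul_eq_mul, Finset.mul_sum, Finset.mul_sum,
      ← Finset.sum_neg_distrib]
    refine Finset.sum_congr rfl fun b _ => ?_
    rw [smul_dotProduct, grad_dotProduct, smul_eq_mul]; ring
  -- Summing against `λ_a^i` evaluates `∏_{j≠b}(ξ - λ_j)` at `λ_a`, which is zero unless `b = a`.
  have hsum : ∀ v, ∑ i : Fin n, fderiv ℝ (κ i) q v * lam a q ^ (i : ℕ) =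
      -2 * (Gt.mat q).det * m a * fderiv ℝ (lam a) q v * Delta a (fun j => lam j q) := by
    intro v
    simp only [hgrad, Finset.sum_mul]
    rw [Finset.sum_comm]
    simp only [mul_assoc _ (prodCoeff _ _ _), ← Finset.mul_sum, sum_prodCoeff_mul_pow]
    rw [Finset.sum_eq_single a (fun b _ hb => by
      rw [prod_erase_eval (y := fun j => lam j q) hb.symm, mul_zero]) (by simp)]
    rfl
  refine ⟨-2 * (Gt.mat q).det * m a * Delta a (fun j => lam j q) +
    ∑ i : Fin n, κ i q * ((i : ℕ) * lam a q ^ ((i : ℕ) - 1)), fun v => ?_⟩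
  have h1 : HasDerivAt (fun t : ℝ => genFun κ (lam a (q + t • v)) (q + t • v)) _ 0 :=
    HasDerivAt.fun_sum fun i _ => (hasDerivAt_line (hκd i) v).mul
      ((hasDerivAt_line (h.family.differentiableAt h.isOpen hq a) v).pow (i : ℕ))
  rw [(hasDerivAt_line hd v).unique h1]
  simp only [zero_smul, add_zero, Finset.sum_add_distrib, hsum, add_mul,
    Finset.sum_mul]
  congr 1
  · ring
  · exact Finset.sum_congr rfl fun i _ => by ring

/-- Directions that fix the `a`-th coordinate are killed by `dλ_a`, hence by the differential of `∑
κ_i λ_a^i`; convexity of the image turns this into constancy. -/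
theorem genFun_symm_eq (h : IsRootChart G Gt lam V e)
    (hκ : IsQuasiPotentialFamily V G Gt M k kt κ) {a : Fin n} {y y' : Fin n → ℝ}
    (hy : y ∈ e.target) (hy' : y' ∈ e.target) (ha : y a = y' a) :
    genFun κ (y a) (e.symm y) = genFun κ (y' a) (e.symm y') := by
  obtain ⟨y₀, r, hball⟩ := h.target
  have hsm := contDiffOn_genFun hκ.smooth (h.family.smooth a)
  have hlam : ∀ z ∈ e.target, lam a (e.symm z) = z a := fun z hz => congrFun (h.lam_symm hz) a
  have key := eq_of_fderiv_eq_zero (f := fun z => genFun κ (lam a (e.symm z)) (e.symm z))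
    e.open_target (hball ▸ convex_ball y₀ r)
    ((hsm.comp h.smooth_symm fun z hz => h.symm_mem hz).differentiableOn (by simp))
    (a := a) (fun z hz u hu => ?_) hy hy' ha
  · simpa only [hlam y hy, hlam y' hy'] using key
  have hq := h.symm_mem hz
  have he : DifferentiableAt ℝ e.symm z :=
    (h.smooth_symm.contDiffAt (e.open_target.mem_nhds hz)).differentiableAt (by simp)
  have hd : DifferentiableAt ℝ (fun q => genFun κ (lam a q) q) (e.symm z) :=
    (hsm.contDiffAt (h.isOpen.mem_nhds hq)).differentiableAt (by simp)
  have hl := h.family.differentiableAt h.isOpen hq a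
  obtain ⟨s, hs⟩ := h.exists_fderiv_genFun hκ hq a
  have h1 : fderiv ℝ (fun z => lam a (e.symm z)) z u = 0 := by
    have : (fun z => lam a (e.symm z)) =ᶠ[nhds z] fun z => z a := by
      filter_upwards [e.open_target.mem_nhds hz] with w hw using hlam w hw
    rw [this.fderiv_eq, (hasFDerivAt_apply a z).fderiv]
    exact hu
  rw [← Function.comp_def (lam a) e.symm, fderiv_comp z hl he] at h1
  have h2 := congrArg (fun L => L u) (fderiv_comp z hd he)
  refine h2.trans ?_
  rw [ContinuousLinearMap.comp_apply, hs]
  exact (congrArg (s * ·) h1).trans (mul_zero s)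

theorem update_mem (h : IsRootChart G Gt lam V e) :
    ∃ y₀ : Fin n → ℝ, ∀ y ∈ e.target, ∀ a, Function.update y₀ a (y a) ∈ e.target := by
  obtain ⟨y₀, r, hball⟩ := h.target
  refine ⟨y₀, fun y hy a => ?_⟩
  rw [hball, Metric.mem_ball] at hy ⊢
  have hr := dist_nonneg.trans_lt hy
  rw [dist_pi_lt_iff hr] at hy ⊢
  intro b
  by_cases hb : b = a
  · subst hb; simpa using hy b
  · simpa [hb] using hr

theorem exists_staeckel (h : IsRootChart G Gt lam V e)
    (hκ : IsQuasiPotentialFamily V G Gt M k kt κ) :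
    ∃ f : Fin n → ℝ → ℝ → ℝ,
      (∀ j, ContDiffOn ℝ ∞ (fun w : ℝ × ℝ => f j w.1 w.2) ((lam j '' V) ×ˢ Set.univ)) ∧
      ∀ i ≤ n, ∀ z ∈ h.phaseChart.target,
        hamiltonian G Gt κ i (h.phaseChart.symm z) =
          -(∑ j, grad (viete i) z.1 j * f j (z.1 j) (z.2.1 j) / Delta j z.1)
            + z.2.2 * viete i z.1 := by
  obtain ⟨y₀, hy₀⟩ := h.update_mem
  -- The potential part may be evaluated with all other roots frozen at the centre of the box, as it
  -- does not depend on them.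
  refine ⟨fun j s u => -4 * (pencilData G Gt s).borderedDet * u ^ 2 +
    genFun κ s (e.symm (Function.update y₀ j s)), fun j => ?_, fun i hi z hz => ?_⟩
  · refine ContDiffOn.add ?_ ?_
    · exact ((contDiff_const.mul
        ((contDiff_borderedDet_pencilData G Gt).comp contDiff_fst)).mul
          (contDiff_snd.pow 2)).contDiffOn
    · have hmaps : Set.MapsTo (fun w : ℝ × ℝ => Function.update y₀ j w.1)
          ((lam j '' V) ×ˢ Set.univ) e.target := by
        rintro ⟨s, u⟩ ⟨⟨q, hq, rfl⟩, -⟩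
        exact hy₀ _ (h.lam_mem hq) j
      have hup : ContDiff ℝ ∞ (fun w : ℝ × ℝ => Function.update y₀ j w.1) :=
        (contDiff_update _ y₀ j).comp contDiff_fst
      simp only [genFun]
      exact ContDiffOn.sum fun i _ => ((hκ.smooth i).comp (h.smooth_symm.comp hup.contDiffOn hmaps)
        fun w hw => h.symm_mem (hmaps hw)).mul (contDiff_fst.pow _).contDiffOn
  · obtain ⟨y, m, c'⟩ := z
    have hy : y ∈ e.target := hz.1
    have hq := h.symm_mem hy
    have hlam := h.lam_symm hy
    refine (h.hamiltonian_phaseOfRoot κ (x := (e.symm y, m, c')) hq i).trans ?_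
    simp only [hlam, grad_viete, neg_mul, neg_div, Finset.sum_neg_distrib, neg_neg]
    congr 1
    have hinj := (h.frame _ hq).inj
    rw [hlam] at hinj
    split_ifs with hin
    · have hgen : ∀ a, genFun κ (y a) (e.symm (Function.update y₀ a (y a))) =
          genFun κ (y a) (e.symm y) := fun a => by
        have := h.genFun_symm_eq hκ (a := a) (hy₀ y hy a) hy (by simp)
        rwa [Function.update_self] at this
      have h1 := coeff_eq_sum_prodCoeff hinj (fun j => κ j (e.symm y)) ⟨i, hin⟩
      simp only at h1
      rw [h1, Finset.mul_sum, ← Finset.sum_add_distrib]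
      refine Finset.sum_congr rfl fun a _ => ?_
      have h2 := h.det_mul_Delta hq a
      rw [hlam, show lam a (e.symm y) = y a from congrFun hlam a] at h2
      rw [hgen, genFun, show ∀ P g u : ℝ, (Gt.mat (e.symm y)).det * (P * (g * u)) =
        P * ((Gt.mat (e.symm y)).det * g) * u from fun P g u => by ring, h2]
      ring
    -- For `i = n` the separated sum is zero: `∏_{j≠a}(ξ - λ_j)` has degree below `n`.
    · have hin' : i = n := by omega
      subst hin'
      simp [prodCoeff_erase_top]

end IsRootChart
end BiCofactor

/-! ### Existence of quasi-potentials and the recursion formula. -/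

namespace BiCofactor
open CofactorData
variable {n : ℕ} {U V : Set (Fin n → ℝ)} {G Gt : CofactorData n} {M : (Fin n → ℝ) → Fin n → ℝ}
  {k kt : (Fin n → ℝ) → ℝ} {κ : Fin n → (Fin n → ℝ) → ℝ}
  {lam : Fin n → (Fin n → ℝ) → ℝ} {e : OpenPartialHomeomorph (Fin n → ℝ) (Fin n → ℝ)}

section Potentials
variable {S : Set (Fin n → ℝ)} {K K₀ : (Fin n → ℝ) → ℝ}

theorem grad_prodCoeff (s : Finset (Fin n)) (i : ℕ) (y : Fin n → ℝ) (b : Fin n) :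
    grad (prodCoeff s i) y b = if b ∈ s then -prodCoeff (s.erase b) i y else 0 := by
  rw [grad, (hasFDerivAt_prodCoeff s i y).fderiv]
  simp only [_root_.neg_apply, _root_.sum_apply, _root_.smul_apply,
    ContinuousLinearMap.proj_apply, Pi.single_apply, smul_eq_mul, mul_ite, mul_one, mul_zero,
    Finset.sum_ite_eq']
  split_ifs <;> simp

theorem grad_mul {f g : (Fin n → ℝ) → ℝ} {y : Fin n → ℝ} (hf : DifferentiableAt ℝ f y)
    (hg : DifferentiableAt ℝ g y) (b : Fin n) :
    grad (fun y => f y * g y) y b = f y * grad g y b + grad f y b * g y := by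
  simp only [grad]
  rw [fderiv_fun_mul hf hg]
  simp [mul_comm]

theorem grad_prodCoeff_mul (hS : IsOpen S) (hK : ContDiffOn ℝ ∞ K S) {y : Fin n → ℝ} (hy : y ∈ S)
    (i : ℕ) {a b : Fin n} (hab : a ≠ b) :
    grad (fun y => prodCoeff (Finset.univ.erase a) i y * grad K y a) y b =
      prodCoeff (Finset.univ.erase a) i y * hess K y a b -
        prodCoeff ((Finset.univ.erase a).erase b) i y * grad K y a := by
  rw [grad_mul ((contDiff_prodCoeff _ i).differentiable (by simp) y)
    (differentiableAt_grad hS hK hy a), grad_prodCoeff, if_pos (by simp [hab.symm])]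
  rw [neg_mul, ← sub_eq_add_neg]; rfl

/-- The compatibility of `dK` and `dK₀` forces an Euler–Poisson–Darboux equation for `K`. -/
theorem euler_poisson_darboux (hS : IsOpen S) (hK : ContDiffOn ℝ ∞ K S)
    (hK₀ : ContDiffOn ℝ ∞ K₀ S)
    (h : ∀ y ∈ S, ∀ a, grad K₀ y a = prodCoeff (Finset.univ.erase a) 0 y * grad K y a)
    {y : Fin n → ℝ} (hy : y ∈ S) {a b : Fin n} (hab : a ≠ b) :
    (y a - y b) * hess K y a b = grad K y a - grad K y b := by
  -- Off the coordinate hyperplanes the common factor `∏_{j≠a,b}(-y_j)` can be cancelled; density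
  -- and continuity then give the equation everywhere.
  set D : Set (Fin n → ℝ) := Set.univ.pi fun _ => ({0}ᶜ : Set ℝ) with hD
  have hDd : Dense D := dense_pi _ fun _ _ => dense_compl_singleton 0
  set F : (Fin n → ℝ) → ℝ := fun y =>
    (y a - y b) * hess K y a b - (grad K y a - grad K y b) with hF
  have hFc : ContinuousOn F S := by
    have h1 : ∀ a, ContinuousOn (fun y => grad K y a) S := fun a =>
      (contDiffOn_grad hS hK a).continuousOn
    have h2 : ContinuousOn (fun y => hess K y a b) S :=
      (contDiffOn_grad hS (contDiffOn_grad hS hK a) b).continuousOn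
    exact (ContinuousOn.mul (by fun_prop) h2).sub ((h1 a).sub (h1 b))
  have hF0 : ∀ y ∈ S, y ∈ D → F y = 0 := by
    intro y hy hyD
    have hh : ∀ {a b : Fin n}, a ≠ b → hess K₀ y a b =
        prodCoeff (Finset.univ.erase a) 0 y * hess K y a b -
          prodCoeff ((Finset.univ.erase a).erase b) 0 y * grad K y a := fun {a b} hab => by
      rw [← grad_prodCoeff_mul hS hK hy 0 hab]
      have : (fun y => grad K₀ y a) =ᶠ[nhds y]
          fun y => prodCoeff (Finset.univ.erase a) 0 y * grad K y a := by
        filter_upwards [hS.mem_nhds hy] with x hx using h x hx a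
      exact congrArg (fun L : (Fin n → ℝ) →L[ℝ] ℝ => L (Pi.single b 1)) this.fderiv_eq
    have hsymm : ∀ {K : (Fin n → ℝ) → ℝ}, ContDiffOn ℝ ∞ K S → hess K y a b = hess K y b a :=
      fun hK => congrFun (congrFun (transpose_hess hS hK hy) b) a
    have h1 := hh hab
    rw [hsymm hK₀, hh hab.symm, ← hsymm hK, Finset.erase_right_comm] at h1
    have h2 := prodCoeff_erase_sub hab 0 y
    have h3 : prodCoeff ((Finset.univ.erase a).erase b) 0 y ≠ 0 := by
      rw [prodCoeff, coeff_zero_eq_eval_zero, eval_prod]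
      refine Finset.prod_ne_zero_iff.2 fun j _ => ?_
      have := hyD j trivial
      simpa using this
    have h4 : prodCoeff ((Finset.univ.erase a).erase b) 0 y * F y = 0 := by
      rw [hF]; linear_combination -h1 - hess K y a b * h2
    exact (mul_eq_zero.1 h4).resolve_left h3
  have : F y = 0 := by
    by_contra hne
    obtain ⟨x, ⟨hx, hxF⟩, hxD⟩ := hDd.inter_open_nonempty _
      (hFc.isOpen_inter_preimage hS (isOpen_compl_singleton (x := (0 : ℝ)))) ⟨y, hy, hne⟩
    exact hxF (hF0 x hx hxD)
  exact sub_eq_zero.1 this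

/-- By the Euler–Poisson–Darboux equation and `prodCoeff_erase_sub`, the prescribed 1-form is closed
for every `i`, not only for `i = 0`. The Poincaré lemma on a convex set integrates it. -/
theorem exists_potential (hS : IsOpen S) (hc : Convex ℝ S) (hK : ContDiffOn ℝ ∞ K S)
    (hK₀ : ContDiffOn ℝ ∞ K₀ S)
    (h : ∀ y ∈ S, ∀ a, grad K₀ y a = prodCoeff (Finset.univ.erase a) 0 y * grad K y a) (i : ℕ) :
    ∃ f, ContDiffOn ℝ ∞ f S ∧
      ∀ y ∈ S, ∀ a, grad f y a = prodCoeff (Finset.univ.erase a) i y * grad K y a := by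
  set c : Fin n → (Fin n → ℝ) → ℝ := fun a y =>
    prodCoeff (Finset.univ.erase a) i y * grad K y a with hcdef
  have hcs : ∀ a, ContDiffOn ℝ ∞ (c a) S := fun a =>
    (contDiff_prodCoeff _ i).contDiffOn.mul (contDiffOn_grad hS hK a)
  set η : (Fin n → ℝ) → (Fin n → ℝ) →L[ℝ] ℝ := fun y =>
    ∑ a, c a y • (ContinuousLinearMap.proj a : (Fin n → ℝ) →L[ℝ] ℝ) with hη
  have hηs : ContDiffOn ℝ ∞ η S := ContDiffOn.sum fun a _ => (hcs a).smul contDiffOn_const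
  have hηv : ∀ y v, η y v = ∑ a, c a y * v a := fun y v => by
    simp [hη]
  have hclosed : ∀ y ∈ S, ∀ a b, grad (c a) y b = grad (c b) y a := by
    intro y hy a b
    by_cases hab : a = b
    · rw [hab]
    rw [grad_prodCoeff_mul hS hK hy i hab, grad_prodCoeff_mul hS hK hy i (Ne.symm hab),
      Finset.erase_right_comm (a := b),
      show hess K y b a = hess K y a b from congrFun (congrFun (transpose_hess hS hK hy) a) b]
    linear_combination hess K y a b * prodCoeff_erase_sub hab i y +
      prodCoeff ((Finset.univ.erase a).erase b) i y * euler_poisson_darboux hS hK hK₀ h hy hab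
  have hfd : ∀ y ∈ S, ∀ x v, fderiv ℝ η y x v = ∑ a, ∑ b, grad (c a) y b * x b * v a := by
    intro y hy x v
    have h1 : HasFDerivAt η (∑ a, (fderiv ℝ (c a) y).smulRight
        (ContinuousLinearMap.proj a : (Fin n → ℝ) →L[ℝ] ℝ)) y :=
      HasFDerivAt.fun_sum fun a _ => (((hcs a).contDiffAt (hS.mem_nhds hy)).differentiableAt
        (by simp)).hasFDerivAt.smul_const (ContinuousLinearMap.proj a : (Fin n → ℝ) →L[ℝ] ℝ)
    rw [h1.fderiv]
    simp only [_root_.sum_apply, ContinuousLinearMap.smulRight_apply,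
      _root_.smul_apply, ContinuousLinearMap.proj_apply, smul_eq_mul,
      ← grad_dotProduct, dotProduct, Finset.sum_mul]
  obtain ⟨f, hf⟩ := hc.exists_forall_hasFDerivAt_of_fderiv_symmetric hS
    (hηs.differentiableOn (by simp)) fun y hy x v => by
      rw [hfd y hy, hfd y hy, Finset.sum_comm]
      exact Finset.sum_congr rfl fun a _ => Finset.sum_congr rfl fun b _ => by
        rw [hclosed y hy a b]; ring
  refine ⟨f, (contDiffOn_infty_iff_fderiv_of_isOpen hS).2
    ⟨fun y hy => (hf y hy).differentiableAt.differentiableWithinAt,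
      hηs.congr fun y hy => (hf y hy).fderiv⟩, fun y hy a => ?_⟩
  rw [grad, (hf y hy).fderiv, hηv]
  simp [Pi.single_apply, hcdef]

end Potentials

theorem adjugate_mulVec_mat (q v : Fin n → ℝ) :
    (G.mat q).adjugate *ᵥ (G.mat q *ᵥ v) = (G.mat q).det • v := by
  rw [mulVec_mulVec, adjugate_mul, smul_mulVec, one_mulVec]

theorem cofCoeff_zero (q : Fin n → ℝ) : cofCoeff G Gt 0 q = (G.mat q).adjugate := by
  have h1 := RingHom.map_adjugate (evalRingHom (0 : ℝ)) (pencil G Gt q)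
  have h2 : (evalRingHom (0 : ℝ)).mapMatrix (pencil G Gt q) = G.mat q := by
    ext i j; simp [pencil]
  rw [h2] at h1
  rw [← h1]
  ext i j
  simp [cofCoeff, coeff_zero_eq_eval_zero]

namespace IsRootChart

theorem rootCovector_injective (h : IsRootChart G Gt lam V e) {q : Fin n → ℝ} (hq : q ∈ V) :
    Function.Injective (rootCovector lam q) :=
  mulVec_injective_of_isUnit ((isUnit_iff_isUnit_det _).2
    (by rw [det_transpose]; exact isUnit_iff_ne_zero.2 (h.frame q hq).det_A))

theorem grad_comp_lam (h : IsRootChart G Gt lam V e) {f : (Fin n → ℝ) → ℝ}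
    (hf : ContDiffOn ℝ ∞ f e.target) {q : Fin n → ℝ} (hq : q ∈ V) :
    grad (fun q => f fun i => lam i q) q = rootCovector lam q (grad f fun i => lam i q) := by
  have hfd : DifferentiableAt ℝ f fun i => lam i q :=
    (hf.contDiffAt (e.open_target.mem_nhds (h.lam_mem hq))).differentiableAt (by simp)
  have hl : DifferentiableAt ℝ (fun q i => lam i q) q :=
    (h.family.contDiffAt h.isOpen hq).differentiableAt (by simp)
  ext j
  rw [grad, fderiv_fun_comp q hfd hl, ContinuousLinearMap.comp_apply, ← grad_dotProduct,
    rootCovector_apply]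
  refine Finset.sum_congr rfl fun a _ => ?_
  congr 1
  rw [fderiv_pi fun i => h.family.differentiableAt h.isOpen hq i]
  rfl

theorem grad_eq_rootCovector (h : IsRootChart G Gt lam V e) {f : (Fin n → ℝ) → ℝ}
    (hf : ContDiffOn ℝ ∞ f V) {q : Fin n → ℝ} (hq : q ∈ V) :
    grad f q = rootCovector lam q (grad (fun y => f (e.symm y)) fun i => lam i q) := by
  rw [← h.grad_comp_lam (f := fun y => f (e.symm y)) (hf.comp h.smooth_symm fun y hy => h.symm_mem hy) hq]
  have : f =ᶠ[nhds q] fun q => f (e.symm fun i => lam i q) := by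
    filter_upwards [h.isOpen.mem_nhds hq] with x hx
    rw [h.symm_lam hx]
  ext j
  rw [grad, grad, this.fderiv_eq]

theorem exists_quasiPotentialFamily (h : IsRootChart G Gt lam V e)
    (hsys : IsBiCofactorSystem V G Gt M k kt) :
    ∃ κ, IsQuasiPotentialFamily V G Gt M k kt κ := by
  set K := fun y => kt (e.symm y) with hKdef
  set K₀ := fun y => k (e.symm y) with hK₀def
  have hmaps : Set.MapsTo e.symm e.target V := fun y hy => h.symm_mem hy
  have hK : ContDiffOn ℝ ∞ K e.target := hsys.smooth_kt.comp h.smooth_symm hmaps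
  have hK₀ : ContDiffOn ℝ ∞ K₀ e.target := hsys.smooth_k.comp h.smooth_symm hmaps
  have hgrad : ∀ q ∈ V, ∀ m, M q = Gt.mat q *ᵥ rootCovector lam q m →
      (grad K fun i => lam i q) = (-2 * (Gt.mat q).det) • m := by
    intro q hq m hm
    refine h.rootCovector_injective hq ?_
    rw [← h.grad_eq_rootCovector hsys.smooth_kt hq,
      eq_neg_of_add_eq_zero_right (hsys.quasi_kt q hq), hm, adjugate_mulVec_mat,
      rootCovector, rootCovector, mulVec_smul, smul_smul, ← neg_smul, neg_mul]
  have hcomp : ∀ y ∈ e.target, ∀ a,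
      grad K₀ y a = prodCoeff (Finset.univ.erase a) 0 y * grad K y a := by
    intro y hy a
    have hq := h.symm_mem hy
    obtain ⟨m, hm⟩ := h.exists_rootCovector hq (M (e.symm y))
    have h1 := hgrad _ hq m hm
    have h2 : (grad K₀ fun i => lam i (e.symm y)) = (-2 * (Gt.mat (e.symm y)).det) • fun a =>
        prodCoeff (Finset.univ.erase a) 0 (fun b => lam b (e.symm y)) * m a := by
      refine h.rootCovector_injective hq ?_
      rw [← h.grad_eq_rootCovector hsys.smooth_k hq,
        eq_neg_of_add_eq_zero_right (hsys.quasi_k _ hq), ← cofCoeff_zero (Gt := Gt), hm,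
        h.cofCoeff_mulVec hq, rootCovector, rootCovector, mulVec_smul, smul_smul, ← neg_smul,
        neg_mul]
    rw [h.lam_symm hy] at h1 h2
    rw [h1, h2]
    simp only [Pi.smul_apply, smul_eq_mul]
    ring
  have hconv : Convex ℝ e.target := by
    obtain ⟨y₀, r, hball⟩ := h.target
    exact hball ▸ convex_ball y₀ r
  choose f hf hfg using exists_potential e.open_target hconv hK hK₀ hcomp
  have hfs : ∀ i, ContDiffOn ℝ ∞ (fun q => f i fun a => lam a q) V := fun i =>
    (hf i).comp (contDiffOn_pi.2 h.family.smooth) fun q hq => h.lam_mem hq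
  -- The end potentials are `k` and `k̃` themselves, since integration determines them only up to a
  -- constant. For `n = 1` the two ends coincide, which is where `dim_one` enters.
  refine ⟨fun i => if (i : ℕ) = 0 then k else if (i : ℕ) + 1 = n then kt else
    fun q => f i fun a => lam a q, fun i => ?_, fun i hi q _ => by simp [hi], fun i hi q hq => ?_,
    fun i q hq => ?_⟩
  · split_ifs
    exacts [hsys.smooth_k, hsys.smooth_kt, hfs i]
  · simp only [hi, if_true]
    split_ifs with h0
    · exact hsys.dim_one (by omega) q hq
    · rfl
  · split_ifs with h0 h1
    · rw [h0, cofCoeff_zero]; exact hsys.quasi_k q hq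
    · obtain ⟨m, hm⟩ := h.exists_rootCovector hq (M q)
      have h2 := hsys.quasi_kt q hq
      rw [hm, adjugate_mulVec_mat] at h2
      rw [show (i : ℕ) = n - 1 by omega, hm, h.cofCoeff_mulVec hq]
      simpa only [prodCoeff_erase_last, one_mul] using h2
    · obtain ⟨m, hm⟩ := h.exists_rootCovector hq (M q)
      have h2 : grad (f i) (fun a => lam a q) = (-2 * (Gt.mat q).det) • fun a =>
          prodCoeff (Finset.univ.erase a) i (fun b => lam b q) * m a := by
        ext a
        rw [hfg i _ (h.lam_mem hq), hgrad q hq m hm]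
        simp only [Pi.smul_apply, smul_eq_mul]
        ring
      rw [h.grad_comp_lam (hf i) hq, h2, hm, h.cofCoeff_mulVec hq, rootCovector, rootCovector,
        mulVec_smul, smul_smul, ← add_smul]
      simp

theorem genFun_nextPotential (h : IsRootChart G Gt lam V e) (hn : 1 ≤ n)
    (hκ : IsQuasiPotentialFamily V G Gt M k kt κ) {q : Fin n → ℝ} (hq : q ∈ V) (ξ : ℝ) :
    genFun (nextPotential G Gt kt κ) ξ q =
      (∏ i, (ξ - lam i q)) * kt q - ξ * genFun κ ξ q := by
  set Q : ℝ[X] := ∑ j, C (κ j q) * X ^ (j : ℕ) with hQ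
  set R : ℝ[X] := ∏ j, ((X : ℝ[X]) - C (lam j q)) with hR
  set P : ℝ[X] := C (kt q / (Gt.mat q).det) * (pencil G Gt q).det - X * Q with hP
  have hT := (h.frame q hq).det_T
  have hPR : P = C (kt q) * R - X * Q := by
    rw [hP, show (pencil G Gt q).det = _ from (h.frame q hq).det_pencil, ← mul_assoc, ← C_mul,
      div_mul_cancel₀ _ hT]
  have hRm : R.Monic := monic_prod_of_monic _ _ fun j _ => monic_X_sub_C _
  have hRd : R.natDegree = n := by
    rw [hR, natDegree_prod_of_monic _ _ fun j _ => monic_X_sub_C _]; simp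
  have hQd : Q.natDegree ≤ n - 1 := natDegree_sum_le_of_forall_le _ _ fun j _ =>
    (natDegree_C_mul_X_pow_le _ _).trans (by omega)
  have hQc : Q.coeff (n - 1) = kt q := by
    rw [hQ, finsetSum_coeff, Finset.sum_eq_single ⟨n - 1, by omega⟩]
    · rw [coeff_C_mul_X_pow, if_pos rfl]
      exact hκ.last ⟨n - 1, by omega⟩ (by simp only; omega) q hq
    · intro j _ hj
      rw [coeff_C_mul_X_pow, if_neg fun e => hj (Fin.ext e.symm)]
    · simp
  have hPd : P.natDegree < n + 1 := by
    rw [hPR, Nat.lt_succ_iff]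
    refine (natDegree_sub_le _ _).trans (max_le ((natDegree_C_mul_le _ _).trans hRd.le) ?_)
    refine natDegree_mul_le.trans ?_
    rw [natDegree_X]; omega
  -- The recursion polynomial has formal degree `n`. Its top coefficient cancels because `κ_{n-1} =
  -- k̃`, so the coefficients below `n` determine it.
  have hPc : P.coeff n = 0 := by
    have h1 : R.coeff n = 1 := by rw [← hRd]; exact hRm.coeff_natDegree
    have h2 : (X * Q).coeff n = Q.coeff (n - 1) := by
      obtain ⟨m, rfl⟩ : ∃ m, n = m + 1 := ⟨n - 1, by omega⟩
      exact coeff_X_mul _ _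
    rw [hPR, coeff_sub, coeff_C_mul, h1, h2, hQc]; ring
  have h1 := eval_eq_sum_range' hPd ξ
  rw [Finset.sum_range_succ, hPc, zero_mul, add_zero, Finset.sum_range, hPR] at h1
  rw [eval_sub, eval_mul, eval_mul, eval_C, eval_X, hR, eval_prod, hQ, eval_finsetSum] at h1
  simp only [eval_sub, eval_X, eval_C, eval_mul, eval_pow] at h1
  rw [genFun, genFun, mul_comm _ (kt q), h1, ← hQ, ← hR, ← hPR]
  rfl

end IsRootChart

theorem IsBiCofactorSystem.mono (h : IsBiCofactorSystem U G Gt M k kt) (hV : V ⊆ U) :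
    IsBiCofactorSystem V G Gt M k kt where
  det_ne_zero q hq := h.det_ne_zero q (hV hq)
  smooth_k := h.smooth_k.mono hV
  smooth_kt := h.smooth_kt.mono hV
  quasi_k q hq := h.quasi_k q (hV hq)
  quasi_kt q hq := h.quasi_kt q (hV hq)
  dim_one hn q hq := h.dim_one hn q (hV hq)

end BiCofactor

/-! ### Assembly of the theorem. -/

theorem mainTheorem1 {n : ℕ} (hn : 1 ≤ n) (U : Set (Fin n → ℝ)) (hU : IsOpen U)
    (G Gt : CofactorData n) (M : (Fin n → ℝ) → Fin n → ℝ) (k kt : (Fin n → ℝ) → ℝ)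
    (hsys : BiCofactor.IsBiCofactorSystem U G Gt M k kt)
    (lam : Fin n → (Fin n → ℝ) → ℝ)
    (hroots : BiCofactor.IsRootFamily U G Gt lam)
    (hindep : BiCofactor.FunctionallyIndependentOn U lam) :
    -- the roots are distinct, and the denominators of the `μ_i` do not vanish
    (∀ q ∈ U, Function.Injective (fun i => lam i q) ∧
      ∀ i, BiCofactor.muDen G Gt lam i q ≠ 0) ∧
    -- every point of `U` has a neighbourhood `V` over which the following holds
    ∀ q₀ ∈ U, ∃ V : Set (Fin n → ℝ), IsOpen V ∧ q₀ ∈ V ∧ V ⊆ U ∧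
      -- `(λ, μ, c')` are smooth coordinates on `V × ℝ^n × ℝ`, and `λ` are such on `V`
      ∃ (Φ : OpenPartialHomeomorph (BiCofactor.Phase n) (BiCofactor.Phase n))
        (e : OpenPartialHomeomorph (Fin n → ℝ) (Fin n → ℝ)),
        Φ.source = V ×ˢ Set.univ ∧
        (∀ x ∈ Φ.source, Φ x = BiCofactor.dnMap G Gt lam x) ∧
        ContDiffOn ℝ ∞ Φ Φ.source ∧ ContDiffOn ℝ ∞ Φ.symm Φ.target ∧
        e.source = V ∧ (∀ q ∈ V, e q = fun i => lam i q) ∧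
        ContDiffOn ℝ ∞ e e.source ∧ ContDiffOn ℝ ∞ e.symm e.target ∧
        -- the system has quasi-potentials `κ_0 = k, …, κ_{n-1} = k̃` on `V`
        (∃ κ, BiCofactor.IsQuasiPotentialFamily V G Gt M k kt κ) ∧
        -- and for every choice of them:
        ∀ κ, BiCofactor.IsQuasiPotentialFamily V G Gt M k kt κ →
          -- `Π₀`, `Π₁` have the Darboux-Nijenhuis form
          BiCofactor.HasDNForm Φ (BiCofactor.Pi0 Gt) (BiCofactor.Pi1 G M)
            (BiCofactor.hamiltonian G Gt κ (n - 1)) ∧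
          -- the Hamiltonians have the generalized Staeckel form
          (∃ f : Fin n → ℝ → ℝ → ℝ,
            (∀ j, ContDiffOn ℝ ∞ (fun w : ℝ × ℝ => f j w.1 w.2) ((lam j '' V) ×ˢ Set.univ)) ∧
            ∀ i ≤ n, ∀ z ∈ Φ.target,
              BiCofactor.hamiltonian G Gt κ i (Φ.symm z) =
                -(∑ j, BiCofactor.grad (BiCofactor.viete i) z.1 j * f j (z.1 j) (z.2.1 j) /
                    BiCofactor.Delta j z.1)
                  + z.2.2 * BiCofactor.viete i z.1) ∧
          -- the recursion formula in the coordinates `λ`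
          ∀ y ∈ e.target, ∀ ξ : ℝ,
            BiCofactor.genFun (BiCofactor.nextPotential G Gt kt κ) ξ (e.symm y) =
              (ξ • (1 : Matrix (Fin n) (Fin n) ℝ) - Matrix.diagonal y).det * kt (e.symm y)
                - ξ * BiCofactor.genFun κ ξ (e.symm y) := by
  have hT := hsys.det_ne_zero
  refine ⟨fun q hq => ?_, fun q₀ hq₀ => ?_⟩
  · have hinj := hroots.injective hU hindep hT hq
    exact ⟨hinj, fun i =>
      (hroots.rootFrame hU hindep hq (hT q hq) hinj).dotProduct_adjugate_ne_zero i⟩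
  · obtain ⟨V, hVU, hmem, e, he⟩ := hroots.exists_chart hU hindep hT hq₀
    refine ⟨V, he.isOpen, hmem, hVU, he.phaseChart, e, rfl, fun x _ => rfl, he.contDiffOn_dnMap,
      he.contDiffOn_dnInv, he.source, he.coe, ?_, he.smooth_symm,
      he.exists_quasiPotentialFamily (hsys.mono hVU), fun κ hκ =>
        ⟨he.hasDNForm hn hκ, he.exists_staeckel hκ, fun y hy ξ => ?_⟩⟩
    · rw [he.source]
      exact (contDiffOn_pi.2 he.family.smooth).congr he.coe
    · rw [he.genFun_nextPotential hn hκ (he.symm_mem hy), ← Matrix.diagonal_one,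
        ← Matrix.diagonal_smul, Matrix.diagonal_sub, Matrix.det_diagonal]
      simp [show ∀ i, lam i (e.symm y) = y i from congrFun (he.lam_symm hy)]
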